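/- **Setting.** A curve is a smooth regular injective map $\gamma:[0,1]\to\mathbb S^2$ together with a continuous unit normal field $\nu$ along it (tangent to $\mathbb S^2$, orthogonal to $\gamma'$); $\tau$ is its outward unit tangent at its two ends. A network $\mathcal N$ is a finite family of curves $\gamma^1,\dots,\gamma^n$ that meet one another only at common endpoints, with exterior tangents at each endpoint pairwise distinct, whose set of endpoints is written as a disjoint union $\mathcal P\sqcup\mathcal Q$ of interior and boundary endpoints. A function on $\mathcal N$ is a tuple $\phi=(\phi^1,\dots,\phi^n)$ of functions on the curves. For a set $X$ of endpoints let $V(X)=\bigoplus_{x\in X}\mathbb R^{j_x}$, with its Euclidean inner product, where $j_x$ is the number of curves ending at $x$; let $V_1(X)\subset V(X)$ consist of the vectors whose components at each $x\in X$ are $(Y\cdot\nu^1_x,\dots,Y\cdot\nu^{j_x}_x)$ for some $Y\in T_x\mathbb S^2$, and let $V_2(X)=V_1(X)^\perp$. Let $d\in C^\infty(\mathcal N)$, $L=\Delta+d$, where $\Delta$ is the second derivative in arc length, and $\mathcal L(\phi,\psi)=\int_{\mathcal N}\nabla\phi\cdot\nabla\psi-d\,\phi\psi$. (The stability operator of the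 length is the case $d\equiv1$.) Let $W^{1,2}_{0,1}(\mathcal N)$ be the space of $W^{1,2}$ functions $\phi$ with $\phi|_{\mathcal P}\in V_1(\mathcal P)$ and $\phi|_{\mathcal Q}=0$. $\mathrm{Ind}(\mathcal N)$ is the maximal dimension of a subspace of $W^{1,2}_{0,1}(\mathcal N)$ on which $\mathcal L$ is negative definite, and $\mathrm{Nul}(\mathcal N)$ is the dimension of $\{\phi\in W^{1,2}_{0,1}(\mathcal N):\mathcal L(\phi,\psi)=0\ \ \forall\psi\in W^{1,2}_{0,1}(\mathcal N)\}$. Let $\mathcal J_0^0(\mathcal N)$ be the space of $u\in C^\infty(\mathcal N)$ with $Lu=0$, $u|_{\mathcal P}\in V_1(\mathcal P)$, $\frac{\partial u}{\partial\tau}|_{\mathcal P}\in V_2(\mathcal P)$ and $u|_{\mathcal Q}=0$. **Dirichlet-to-Neumann map.** For $\tilde{\mathcal Q}\subset\mathcal Q$ let $D(\tilde{\mathcal Q})=\{\frac{\partial u}{\partial\tau}|_{\tilde{\mathcal Q}}:u\in\mathcal J_0^0(\mathcal N)\}\subset V(\tilde{\mathcal Q})$. For $g\in D(\tilde{\mathcal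 Q})^\perp$, the $L$-extension of $g$ is the function $u_g\in C^\infty(\mathcal N)$ with $Lu_g=0$, $u_g|_{\mathcal P}\in V_1(\mathcal P)$, $\frac{\partial u_g}{\partial\tau}|_{\mathcal P}\in V_2(\mathcal P)$, $u_g=g$ on $\tilde{\mathcal Q}$, $u_g=0$ on $\mathcal Q\setminus\tilde{\mathcal Q}$, $\frac{\partial u_g}{\partial\tau}|_{\tilde{\mathcal Q}}\in D(\tilde{\mathcal Q})^\perp$, and $u_g$ orthogonal in $L^2(\mathcal N)$ to every $v\in\mathcal J_0^0(\mathcal N)$ with $\frac{\partial v}{\partial\tau}=0$ on $\tilde{\mathcal Q}$. The Dirichlet-to-Neumann map is $T:D(\tilde{\mathcal Q})^\perp\to D(\tilde{\mathcal Q})^\perp$, $T(g)=\frac{\partial u_g}{\partial\tau}|_{\tilde{\mathcal Q}}$. **Partition.** Networks $\mathcal N_1,\dots,\mathcal N_l$, with interior and boundary endpoint sets $\mathcal P_i,\mathcal Q_i$, form a partition of $\mathcal N$ if the curves of $\mathcal N$ are the disjoint union of the curves of the $\mathcal N_i$, and there are divisions into disjoint sets $\mathcal P=\mathring{\mathcal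 P}\sqcup\overline{\mathcal P}$ and $\mathcal Q_i=\tilde{\mathcal Q}_i\sqcup\overline{\mathcal Q}_i$ such that $\mathring{\mathcal P}=\bigsqcup_i\mathcal P_i$ (a disjoint union), $\overline{\mathcal P}=\bigcup_i\tilde{\mathcal Q}_i$ and $\mathcal Q=\bigcup_i\overline{\mathcal Q}_i$. Each $\mathcal N_i$ carries the restriction of $d$. Let $D_i=D(\tilde{\mathcal Q}_i)\subset V(\tilde{\mathcal Q}_i)$ and let $T_i:D_i^\perp\to D_i^\perp$ be the Dirichlet-to-Neumann map of $\mathcal N_i$ with respect to $\tilde{\mathcal Q}_i$. Identify $V(\overline{\mathcal P})=\bigoplus_iV(\tilde{\mathcal Q}_i)$, let $\hat T=\bigoplus_iT_i$ and $\overline V_1(\overline{\mathcal P})=V_1(\overline{\mathcal P})\cap\bigoplus_iD_i^\perp$, and define $\overline T:\overline V_1(\overline{\mathcal P})\to\overline V_1(\overline{\mathcal P})$ as $\hat T$ followed by the orthogonal projection of $V(\overline{\mathcal P})$ onto $\overline V_1(\overline{\mathcal P})$. $\mathrm{Ind}(\overline T)$ is the dimension of the sum of the eigenspaces of $\overline T$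 with negative eigenvalue, and $\mathrm{Nul}(\overline T)$ is the dimension of the kernel of $\overline T$. **Statement.** Let $\{\mathcal N_i\}_{i=1,\dots,l}$ be a partition of a network $\mathcal N$ and let $d\in C^\infty(\mathcal N)$. Then for each $i$ every $g\in D_i^\perp$ has exactly one $L$-extension on $\mathcal N_i$ with respect to $\tilde{\mathcal Q}_i$ (so that the maps above are well defined), and $$\mathrm{Ind}(\mathcal N)+\mathrm{Nul}(\mathcal N)=\sum_{i=1}^l\bigl(\mathrm{Ind}(\mathcal N_i)+\mathrm{Nul}(\mathcal N_i)\bigr)+\mathrm{Ind}(\overline T)+\mathrm{Nul}(\overline T).$$ -/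

import Mathlib

open MeasureTheory Set
open scoped ContDiff InnerProductSpace

noncomputable section

namespace SphereNetwork

/-- The ambient space of the sphere. -/
abbrev E3 := EuclideanSpace ℝ (Fin 3)

section Interval

variable {F : Type*} [NormedAddCommGroup F] [NormedSpace ℝ F]

/-- A function on `[0,1]`, extended to the line; only its values on `[0,1]` are used below. -/
def lift (f : unitInterval → F) : ℝ → F := IccExtend (zero_le_one' ℝ) f

/-- The derivative on `[0,1]` (one-sided at the two endpoints). -/
def der (f : unitInterval → F) : ℝ → F := derivWithin (lift f) (Icc 0 1)

/-- `f` is `C^∞` on the closed interval `[0,1]`. -/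
def IsSmooth (f : unitInterval → F) : Prop := ContDiffOn ℝ ∞ (lift f) (Icc 0 1)

/-- `f` is the continuous representative of a `W^{1,2}` function on `[0,1]`: absolutely continuous
with square integrable derivative. Its traces at the endpoints are its values there. -/
def IsW12 (f : unitInterval → ℝ) : Prop :=
  AbsolutelyContinuousOnInterval (lift f) 0 1 ∧
    MemLp (der f) 2 (volume.restrict (Icc (0 : ℝ) 1))

end Interval

/-- A smooth regular curve `[0,1] → S²` without self-intersection, together with a unit normal
vector field along it (tangent to the sphere, orthogonal to the curve). -/
structure Curve where
  γ : unitInterval → E3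
  ν : unitInterval → E3
  norm_γ : ∀ t, ‖γ t‖ = 1
  smooth : IsSmooth γ
  regular : ∀ t : unitInterval, der γ t ≠ 0
  injective : Function.Injective γ
  ν_continuous : Continuous ν
  norm_ν : ∀ t, ‖ν t‖ = 1
  ν_tangent : ∀ t, ⟪ν t, γ t⟫_ℝ = 0
  ν_normal : ∀ t : unitInterval, ⟪ν t, der γ t⟫_ℝ = 0

/-- The parameter of an end of a curve: `false` is the initial end, `true` is the final end. -/
def endParam (b : Bool) : unitInterval := if b then 1 else 0

/-- The sign of the outward direction at an end. -/
def endSign (b : Bool) : ℝ := if b then 1 else -1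

namespace Curve

variable (c : Curve)

/-- The speed `|γ'|`. -/
def speed (t : ℝ) : ℝ := ‖der c.γ t‖

/-- The outer unit tangent vector `τ` at an end of the curve. -/
def outerTangent (b : Bool) : E3 :=
  (endSign b / c.speed (endParam b)) • der c.γ (endParam b)

/-- The derivative `∂f/∂τ` (in arc length) at an end of the curve. -/
def conormal (f : unitInterval → ℝ) (b : Bool) : ℝ :=
  endSign b / c.speed (endParam b) * der f (endParam b)

/-- The Laplacian on the curve, i.e. the second derivative in arc length. -/
def laplacian (f : unitInterval → ℝ) (t : ℝ) : ℝ :=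
  derivWithin (fun s => der f s / c.speed s) (Icc 0 1) t / c.speed t

end Curve

/-- An embedded network in `S²` with interior endpoint set `P` and boundary endpoint set `Q`. -/
structure Network where
  n : ℕ
  curve : Fin n → Curve
  P : Set E3
  Q : Set E3
  disjoint_PQ : Disjoint P Q
  endpoints : P ∪ Q = {x | ∃ (i : Fin n) (b : Bool), x = (curve i).γ (endParam b)}
  /-- Two different curves meet only at common endpoints. -/
  embedded : ∀ i j, i ≠ j → ∀ s t, (curve i).γ s = (curve j).γ t →
    (s = 0 ∨ s = 1) ∧ (t = 0 ∨ t = 1)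
  /-- The exterior tangent vectors at an endpoint point in different directions. -/
  tangents_ne : ∀ (i j : Fin n) (b c : Bool), (i, b) ≠ (j, c) →
    (curve i).γ (endParam b) = (curve j).γ (endParam c) →
    (curve i).outerTangent b ≠ (curve j).outerTangent c

section Linearity

lemma lift_add (f g : unitInterval → ℝ) : lift (f + g) = lift f + lift g := rfl

lemma lift_smul (a : ℝ) (f : unitInterval → ℝ) : lift (a • f) = a • lift f := rfl

lemma lift_zero : lift (0 : unitInterval → ℝ) = 0 := rfl

lemma der_zero : der (0 : unitInterval → ℝ) = 0 := by
  funext t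
  simp [der, lift_zero]

lemma der_smul (a : ℝ) (f : unitInterval → ℝ) : der (a • f) = a • der f := by
  funext t
  simp only [der, lift_smul, Pi.smul_apply]
  exact derivWithin_const_smul_field a (lift f)

lemma der_add_of_differentiableWithinAt {f g : unitInterval → ℝ} {t : ℝ}
    (hf : DifferentiableWithinAt ℝ (lift f) (Icc 0 1) t)
    (hg : DifferentiableWithinAt ℝ (lift g) (Icc 0 1) t) :
    der (f + g) t = der f t + der g t := by
  simp only [der, lift_add]
  exact derivWithin_add hf hg

lemma IsSmooth.differentiableWithinAt {F : Type*} [NormedAddCommGroup F] [NormedSpace ℝ F]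
    {f : unitInterval → F} (hf : IsSmooth f) {t : ℝ}
    (ht : t ∈ Icc (0 : ℝ) 1) : DifferentiableWithinAt ℝ (lift f) (Icc 0 1) t :=
  (hf.differentiableOn (by simp)) t ht

lemma IsSmooth.der_contDiffOn {F : Type*} [NormedAddCommGroup F] [NormedSpace ℝ F]
    {f : unitInterval → F} (hf : IsSmooth f) : ContDiffOn ℝ ∞ (der f) (Icc 0 1) :=
  ContDiffOn.derivWithin hf (uniqueDiffOn_Icc zero_lt_one) (by simp)

lemma IsSmooth.der_add {f g : unitInterval → ℝ} (hf : IsSmooth f) (hg : IsSmooth g) {t : ℝ}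
    (ht : t ∈ Icc (0 : ℝ) 1) : der (f + g) t = der f t + der g t :=
  der_add_of_differentiableWithinAt (hf.differentiableWithinAt ht) (hg.differentiableWithinAt ht)

lemma IsSmooth.add {f g : unitInterval → ℝ} (hf : IsSmooth f) (hg : IsSmooth g) :
    IsSmooth (f + g) := by
  unfold IsSmooth
  rw [lift_add]
  exact ContDiffOn.add hf hg

lemma IsSmooth.smul (a : ℝ) {f : unitInterval → ℝ} (hf : IsSmooth f) : IsSmooth (a • f) := by
  unfold IsSmooth
  rw [lift_smul]
  exact contDiffOn_const.smul hf

lemma IsSmooth.zero : IsSmooth (0 : unitInterval → ℝ) := contDiffOn_const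

lemma IsW12.zero : IsW12 0 := by
  refine ⟨?_, ?_⟩
  · have h : ContDiffOn ℝ 1 (fun _ : ℝ => (0 : ℝ)) (uIcc 0 1) := contDiffOn_const
    exact h.absolutelyContinuousOnInterval
  · rw [der_zero]
    exact MemLp.zero

lemma IsW12.smul (a : ℝ) {f : unitInterval → ℝ} (hf : IsW12 f) : IsW12 (a • f) := by
  refine ⟨?_, ?_⟩
  · exact hf.1.const_smul a
  · rw [der_smul]
    exact hf.2.const_smul a

lemma IsW12.der_add {f g : unitInterval → ℝ} (hf : IsW12 f) (hg : IsW12 g) :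
    der (f + g) =ᵐ[volume.restrict (Icc (0 : ℝ) 1)] der f + der g := by
  rw [Filter.EventuallyEq, ae_restrict_iff' measurableSet_Icc]
  filter_upwards [hf.1.ae_differentiableAt, hg.1.ae_differentiableAt] with t h1 h2 ht
  have ht' : t ∈ uIcc (0 : ℝ) 1 := by rwa [uIcc_of_le zero_le_one]
  exact der_add_of_differentiableWithinAt (h1 ht').differentiableWithinAt
    (h2 ht').differentiableWithinAt

lemma IsW12.add {f g : unitInterval → ℝ} (hf : IsW12 f) (hg : IsW12 g) : IsW12 (f + g) :=
  ⟨hf.1.add hg.1, (memLp_congr_ae (hf.der_add hg)).2 (hf.2.add hg.2)⟩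

namespace Curve

variable (c : Curve)

lemma speed_ne_zero {t : ℝ} (ht : t ∈ Icc (0 : ℝ) 1) : c.speed t ≠ 0 :=
  norm_ne_zero_iff.2 (c.regular ⟨t, ht⟩)

lemma speed_contDiffOn : ContDiffOn ℝ ∞ c.speed (Icc 0 1) :=
  c.smooth.der_contDiffOn.norm ℝ fun t ht => c.regular ⟨t, ht⟩

lemma conormal_smul (a : ℝ) (f : unitInterval → ℝ) (b : Bool) :
    c.conormal (a • f) b = a * c.conormal f b := by
  simp only [conormal, der_smul, Pi.smul_apply, smul_eq_mul]
  ring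

lemma conormal_zero (b : Bool) : c.conormal 0 b = 0 := by
  simp [conormal, der_zero]

lemma conormal_add {f g : unitInterval → ℝ} (hf : IsSmooth f) (hg : IsSmooth g) (b : Bool) :
    c.conormal (f + g) b = c.conormal f b + c.conormal g b := by
  simp only [conormal, hf.der_add hg (endParam b).2]
  ring

lemma laplacian_zero (t : ℝ) : c.laplacian 0 t = 0 := by
  simp [laplacian, der_zero]

lemma laplacian_smul (a : ℝ) (f : unitInterval → ℝ) (t : ℝ) :
    c.laplacian (a • f) t = a * c.laplacian f t := by
  simp only [laplacian, der_smul, Pi.smul_apply, smul_eq_mul, mul_div_assoc]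
  rw [derivWithin_const_mul_field, mul_div_assoc]

lemma laplacian_add {f g : unitInterval → ℝ} (hf : IsSmooth f) (hg : IsSmooth g) {t : ℝ}
    (ht : t ∈ Icc (0 : ℝ) 1) :
    c.laplacian (f + g) t = c.laplacian f t + c.laplacian g t := by
  have key : ∀ h : unitInterval → ℝ, IsSmooth h →
      DifferentiableWithinAt ℝ (fun s => der h s / c.speed s) (Icc 0 1) t := fun h hh =>
    ((hh.der_contDiffOn.div c.speed_contDiffOn fun s hs => c.speed_ne_zero hs).differentiableOn
      (by simp)) t ht
  have e : EqOn (fun s => der (f + g) s / c.speed s)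
      ((fun s => der f s / c.speed s) + fun s => der g s / c.speed s) (Icc 0 1) := by
    intro s hs
    simp only [Pi.add_apply, hf.der_add hg hs, add_div]
  simp only [laplacian]
  rw [derivWithin_congr e (e ht), derivWithin_add (key f hf) (key g hg), add_div]

end Curve

end Linearity

namespace Network

variable (N : Network)

/-- A function on the network: a tuple of functions, one on each curve. -/
abbrev Fn := Fin N.n → unitInterval → ℝ

/-- The endpoint of the network at which a given end of a given curve lies. -/
def endpoint (h : Fin N.n × Bool) : E3 := (N.curve h.1).γ (endParam h.2)

/-- The ends of curves that lie at a point of `X`. -/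
abbrev EndsAt (X : Set E3) := {h : Fin N.n × Bool // N.endpoint h ∈ X}

instance (X : Set E3) : Fintype (N.EndsAt X) := Fintype.ofFinite _

/-- The Euclidean space `V(X)`, the direct sum over `x ∈ X` of `ℝ^{j_x}`, where `j_x` is the number
of curves with endpoint `x`. -/
abbrev V (X : Set E3) := EuclideanSpace ℝ (N.EndsAt X)

/-- `V_1(X)`: at each point `x ∈ X` the components are `Y · ν` for one tangent vector `Y` of the
sphere at `x`. -/
def V1 (X : Set E3) : Submodule ℝ (N.V X) where
  carrier := {v | ∀ x ∈ X, ∃ Y : E3, ⟪Y, x⟫_ℝ = 0 ∧ ∀ h : N.EndsAt X, N.endpoint h = x →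
    v h = ⟪Y, (N.curve h.1.1).ν (endParam h.1.2)⟫_ℝ}
  zero_mem' := fun x _ => ⟨0, by simp⟩
  add_mem' := by
    intro v w hv hw x hx
    obtain ⟨Y, hY, hv⟩ := hv x hx
    obtain ⟨Z, hZ, hw⟩ := hw x hx
    refine ⟨Y + Z, by simp [inner_add_left, hY, hZ], fun h hh => ?_⟩
    simp [inner_add_left, hv h hh, hw h hh]
  smul_mem' := by
    intro a v hv x hx
    obtain ⟨Y, hY, hv⟩ := hv x hx
    refine ⟨a • Y, by simp [inner_smul_left, hY], fun h hh => ?_⟩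
    simp [inner_smul_left, hv h hh]

/-- `V_2(X)`, the orthogonal complement of `V_1(X)` in `V(X)`. -/
def V2 (X : Set E3) : Submodule ℝ (N.V X) := (N.V1 X)ᗮ

/-- The restriction of a function to the ends at `X`. -/
def trace (φ : N.Fn) (X : Set E3) : N.V X :=
  WithLp.toLp 2 fun h => φ h.1.1 (endParam h.1.2)

/-- The outer derivative `∂φ/∂τ` at the ends at `X`. -/
def conormal (φ : N.Fn) (X : Set E3) : N.V X :=
  WithLp.toLp 2 fun h => (N.curve h.1.1).conormal (φ h.1.1) h.1.2

/-- The operator `L = Δ + d` on curve `i` at parameter `t`. -/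
def opL (d φ : N.Fn) (i : Fin N.n) (t : unitInterval) : ℝ :=
  (N.curve i).laplacian (φ i) t + d i t * φ i t

/-- The index form `∫_N ∇φ · ∇ψ - d φ ψ`, written in the parameters of the curves. -/
def form (d φ ψ : N.Fn) : ℝ :=
  ∑ i, ∫ t in (0 : ℝ)..1,
    (der (φ i) t * der (ψ i) t / (N.curve i).speed t
      - lift (d i) t * lift (φ i) t * lift (ψ i) t * (N.curve i).speed t)

/-- The `L²` inner product `∫_N φ ψ`. -/
def innerL2 (φ ψ : N.Fn) : ℝ :=
  ∑ i, ∫ t in (0 : ℝ)..1, lift (φ i) t * lift (ψ i) t * (N.curve i).speed t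

lemma trace_zero (X : Set E3) : N.trace 0 X = 0 := rfl

lemma trace_add (φ ψ : N.Fn) (X : Set E3) :
    N.trace (φ + ψ) X = N.trace φ X + N.trace ψ X := rfl

lemma trace_smul (a : ℝ) (φ : N.Fn) (X : Set E3) : N.trace (a • φ) X = a • N.trace φ X := rfl

lemma conormal_zero (X : Set E3) : N.conormal 0 X = 0 := by
  ext h
  exact (N.curve h.1.1).conormal_zero _

lemma conormal_smul (a : ℝ) (φ : N.Fn) (X : Set E3) :
    N.conormal (a • φ) X = a • N.conormal φ X := by
  ext h
  exact (N.curve h.1.1).conormal_smul a _ _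

lemma conormal_add {φ ψ : N.Fn} (hφ : ∀ i, IsSmooth (φ i)) (hψ : ∀ i, IsSmooth (ψ i))
    (X : Set E3) : N.conormal (φ + ψ) X = N.conormal φ X + N.conormal ψ X := by
  ext h
  exact (N.curve h.1.1).conormal_add (hφ _) (hψ _) _

/-- The Sobolev space `W^{1,2}_{0,1}(N)`: trace in `V_1` on `P` and zero trace on `Q`. -/
def W : Submodule ℝ N.Fn where
  carrier := {φ | (∀ i, IsW12 (φ i)) ∧ N.trace φ N.P ∈ N.V1 N.P ∧ N.trace φ N.Q = 0}
  zero_mem' := ⟨fun _ => IsW12.zero, Submodule.zero_mem _, rfl⟩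
  add_mem' := by
    rintro φ ψ ⟨h1, h2, h3⟩ ⟨k1, k2, k3⟩
    refine ⟨fun i => (h1 i).add (k1 i), ?_, ?_⟩
    · rw [trace_add]
      exact Submodule.add_mem _ h2 k2
    · rw [trace_add, h3, k3, add_zero]
  smul_mem' := by
    rintro a φ ⟨h1, h2, h3⟩
    refine ⟨fun i => (h1 i).smul a, ?_, ?_⟩
    · rw [trace_smul]
      exact Submodule.smul_mem _ a h2
    · rw [trace_smul, h3, smul_zero]

/-- The Morse index: the maximal dimension of a subspace of `W^{1,2}_{0,1}(N)` on which the index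
form is negative definite. -/
def index (d : N.Fn) : ℕ∞ :=
  ⨆ S : {S : Submodule ℝ N.Fn // S ≤ N.W ∧ ∀ φ ∈ S, φ ≠ 0 → N.form d φ φ < 0},
    Cardinal.toENat (Module.rank ℝ S.1)

/-- The nullity: the maximal dimension of a subspace of `W^{1,2}_{0,1}(N)` on which the index form
vanishes, in the sense that each of its elements pairs to zero with all of `W^{1,2}_{0,1}(N)`.
It is the multiplicity of `0` as a weak eigenvalue of `L`. -/
def nullity (d : N.Fn) : ℕ∞ :=
  ⨆ S : {S : Submodule ℝ N.Fn // S ≤ N.W ∧ ∀ φ ∈ S, ∀ ψ ∈ N.W, N.form d φ ψ = 0},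
    Cardinal.toENat (Module.rank ℝ S.1)

/-- The smooth solutions of `L u = 0` with `u ∈ V_1` and `∂u/∂τ ∈ V_2` on `P`. -/
def sol (d : N.Fn) : Submodule ℝ N.Fn where
  carrier := {u | (∀ i, IsSmooth (u i)) ∧ (∀ i t, N.opL d u i t = 0) ∧
    N.trace u N.P ∈ N.V1 N.P ∧ N.conormal u N.P ∈ N.V2 N.P}
  zero_mem' := by
    refine ⟨fun _ => IsSmooth.zero, fun i t => ?_, Submodule.zero_mem _, ?_⟩
    · simp [opL, Curve.laplacian_zero]
    · rw [conormal_zero]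
      exact Submodule.zero_mem _
  add_mem' := by
    rintro φ ψ ⟨h1, h2, h3, h4⟩ ⟨k1, k2, k3, k4⟩
    refine ⟨fun i => (h1 i).add (k1 i), fun i t => ?_, ?_, ?_⟩
    · have h := h2 i t
      have k := k2 i t
      simp only [opL, Pi.add_apply, Curve.laplacian_add _ (h1 i) (k1 i) t.2] at h k ⊢
      linarith
    · rw [trace_add]
      exact Submodule.add_mem _ h3 k3
    · rw [N.conormal_add h1 k1]
      exact Submodule.add_mem _ h4 k4
  smul_mem' := by
    rintro a φ ⟨h1, h2, h3, h4⟩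
    refine ⟨fun i => (h1 i).smul a, fun i t => ?_, ?_, ?_⟩
    · have h := h2 i t
      simp only [opL, Pi.smul_apply, Curve.laplacian_smul, smul_eq_mul] at h ⊢
      linear_combination a * h
    · rw [trace_smul]
      exact Submodule.smul_mem _ a h3
    · rw [N.conormal_smul]
      exact Submodule.smul_mem _ a h4

/-- `J_0^0(N)`: the (smooth) eigenfunctions of `L` with eigenvalue `0`. -/
def J00 (d : N.Fn) : Submodule ℝ N.Fn where
  carrier := {u | u ∈ N.sol d ∧ N.trace u N.Q = 0}
  zero_mem' := ⟨Submodule.zero_mem _, rfl⟩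
  add_mem' := by
    rintro φ ψ ⟨h1, h2⟩ ⟨k1, k2⟩
    exact ⟨Submodule.add_mem _ h1 k1, by rw [trace_add, h2, k2, add_zero]⟩
  smul_mem' := by
    rintro a φ ⟨h1, h2⟩
    exact ⟨Submodule.smul_mem _ a h1, by rw [trace_smul, h2, smul_zero]⟩

/-- `D_τ J_0^0(X)`: the values on `X` of `∂u/∂τ` for `u ∈ J_0^0(N)`. -/
def DJ (d : N.Fn) (X : Set E3) : Submodule ℝ (N.V X) where
  carrier := {v | ∃ u ∈ N.J00 d, v = N.conormal u X}
  zero_mem' := ⟨0, Submodule.zero_mem _, (N.conormal_zero X).symm⟩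
  add_mem' := by
    rintro _ _ ⟨u, hu, rfl⟩ ⟨w, hw, rfl⟩
    exact ⟨u + w, Submodule.add_mem _ hu hw, (N.conormal_add hu.1.1 hw.1.1 X).symm⟩
  smul_mem' := by
    rintro a _ ⟨u, hu, rfl⟩
    exact ⟨a • u, Submodule.smul_mem _ a hu, (N.conormal_smul a u X).symm⟩

/-- `u` is the `L`-extension of `g` with respect to the set `X` of boundary endpoints. The last
clause says that `u` is `L²`-orthogonal to the `v ∈ J_0^0(N)` with `∂v/∂τ = 0` on `X`. -/
structure IsLExtension (d : N.Fn) (X : Set E3) (g : N.V X) (u : N.Fn) : Prop where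
  mem_sol : u ∈ N.sol d
  trace_eq : N.trace u X = g
  trace_eq_zero : N.trace u (N.Q \ X) = 0
  conormal_mem : N.conormal u X ∈ (N.DJ d X)ᗮ
  orthogonal : ∀ v ∈ N.J00 d, N.conormal v X = 0 → N.innerL2 u v = 0

open Classical in
/-- The Dirichlet-to-Neumann map `g ↦ ∂u_g/∂τ` with respect to `X`, where `u_g` is the
`L`-extension of `g`. -/
def dn (d : N.Fn) (X : Set E3) (g : (N.DJ d X)ᗮ) : (N.DJ d X)ᗮ :=
  if h : ∃ u, N.IsLExtension d X g u then
    ⟨N.conormal h.choose X, h.choose_spec.conormal_mem⟩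
  else 0

end Network

/-- `M` is a partition of the network `N`: the curves of `N` are the disjoint union of the curves of
the `M i`, `Pin ⊔ Pbar` is a division of the interior endpoints of `N`, and `Qtilde i ⊔ Qbar i` is a
division of the boundary endpoints of `M i`. -/
structure Partition (N : Network) {l : ℕ} (M : Fin l → Network) where
  e : (Σ i, Fin (M i).n) ≃ Fin N.n
  curve_eq : ∀ i j, N.curve (e ⟨i, j⟩) = (M i).curve j
  Pin : Set E3
  Pbar : Set E3
  Qtilde : Fin l → Set E3
  Qbar : Fin l → Set E3
  P_eq : Pin ∪ Pbar = N.P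
  P_disj : Disjoint Pin Pbar
  Q_eq : ∀ i, Qtilde i ∪ Qbar i = (M i).Q
  Q_disj : ∀ i, Disjoint (Qtilde i) (Qbar i)
  Pin_eq : Pin = ⋃ i, (M i).P
  Pin_disj : Pairwise fun i j => Disjoint (M i).P (M j).P
  Pbar_eq : Pbar = ⋃ i, Qtilde i
  NQ_eq : N.Q = ⋃ i, Qbar i

namespace Partition

variable {N : Network} {l : ℕ} {M : Fin l → Network} (p : Partition N M)

/-- The restriction of a function on `N` to the piece `M i`. -/
def restrict (φ : N.Fn) (i : Fin l) : (M i).Fn := fun j => φ (p.e ⟨i, j⟩)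

lemma endpoint_eq (i : Fin l) (j : Fin (M i).n) (b : Bool) :
    N.endpoint (p.e ⟨i, j⟩, b) = (M i).endpoint (j, b) := by
  simp only [Network.endpoint, p.curve_eq]

lemma endpoint_mem_Pbar {i : Fin l} (k : (M i).EndsAt (p.Qtilde i)) :
    N.endpoint (p.e ⟨i, k.1.1⟩, k.1.2) ∈ p.Pbar := by
  rw [endpoint_eq, p.Pbar_eq]
  exact mem_iUnion.2 ⟨i, k.2⟩

lemma endpoint_mem_Qtilde (h : N.EndsAt p.Pbar) :
    (M (p.e.symm h.1.1).1).endpoint ((p.e.symm h.1.1).2, h.1.2) ∈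
      p.Qtilde (p.e.symm h.1.1).1 := by
  obtain ⟨⟨k, b⟩, hk⟩ := h
  have hk' : N.endpoint (p.e (p.e.symm k), b) ∈ p.Pbar := by rwa [Equiv.apply_symm_apply]
  change (M (p.e.symm k).1).endpoint ((p.e.symm k).2, b) ∈ p.Qtilde (p.e.symm k).1
  generalize p.e.symm k = x at hk'
  obtain ⟨i, j⟩ := x
  rw [endpoint_eq] at hk'
  change (M i).endpoint (j, b) ∈ p.Qtilde i
  have hx : (M i).endpoint (j, b) ∈ (M i).P ∪ (M i).Q := by
    rw [(M i).endpoints]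
    exact ⟨j, b, rfl⟩
  rw [← p.Q_eq i] at hx
  rcases hx with hx | hx | hx
  · refine absurd hk' (disjoint_left.1 p.P_disj ?_)
    rw [p.Pin_eq]
    exact mem_iUnion.2 ⟨i, hx⟩
  · exact hx
  · have hP : (M i).endpoint (j, b) ∈ N.P := by
      rw [← p.P_eq]
      exact Or.inr hk'
    refine absurd ?_ (disjoint_left.1 N.disjoint_PQ hP)
    rw [p.NQ_eq]
    exact mem_iUnion.2 ⟨i, hx⟩

/-- The component in `V(Qtilde i)` of an element of `V(Pbar)`. -/
def comp (i : Fin l) : N.V p.Pbar →ₗ[ℝ] (M i).V (p.Qtilde i) where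
  toFun g := WithLp.toLp 2 fun k => g ⟨(p.e ⟨i, k.1.1⟩, k.1.2), p.endpoint_mem_Pbar k⟩
  map_add' _ _ := rfl
  map_smul' _ _ := rfl

/-- The element of `V(Pbar)` with given components in the `V(Qtilde i)`. -/
def glue (g : ∀ i, (M i).V (p.Qtilde i)) : N.V p.Pbar :=
  WithLp.toLp 2 fun h =>
    g (p.e.symm h.1.1).1 ⟨((p.e.symm h.1.1).2, h.1.2), p.endpoint_mem_Qtilde h⟩

/-- The elements of `V_1(Pbar)` all of whose components are orthogonal to
`D_τ J_0^0(Qtilde i)`. -/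
def V1bar (d : N.Fn) : Submodule ℝ (N.V p.Pbar) :=
  N.V1 p.Pbar ⊓ ⨅ i, ((M i).DJ (p.restrict d i) (p.Qtilde i))ᗮ.comap (p.comp i)

lemma comp_mem {d : N.Fn} (g : p.V1bar d) (i : Fin l) :
    p.comp i g ∈ ((M i).DJ (p.restrict d i) (p.Qtilde i))ᗮ :=
  (Submodule.mem_iInf _).1 g.2.2 i

/-- The map `That`, which acts by the Dirichlet-to-Neumann map of each piece. -/
def That (d : N.Fn) (g : p.V1bar d) : N.V p.Pbar :=
  p.glue fun i => (M i).dn (p.restrict d i) (p.Qtilde i) ⟨p.comp i g, p.comp_mem g i⟩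

/-- The glued Dirichlet-to-Neumann map: `That` followed by the orthogonal projection onto
`V1bar`. -/
def Tbar (d : N.Fn) (g : p.V1bar d) : p.V1bar d :=
  (p.V1bar d).orthogonalProjectionOnto (p.That d g)

/-- The eigenspace of `Tbar` for the eigenvalue `σ`. -/
def eigenspace (d : N.Fn) (σ : ℝ) : Submodule ℝ (p.V1bar d) :=
  Submodule.span ℝ {g | p.Tbar d g = σ • g}

/-- `Ind(Tbar)`: the dimension of the sum of the eigenspaces with negative eigenvalue. -/
def indexTbar (d : N.Fn) : ℕ :=
  Module.finrank ℝ (⨆ σ : {σ : ℝ // σ < 0}, p.eigenspace d σ : Submodule ℝ (p.V1bar d))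

/-- `Nul(Tbar)`: the dimension of the eigenspace with eigenvalue `0`. -/
def nullityTbar (d : N.Fn) : ℕ := Module.finrank ℝ (p.eigenspace d 0)

end Partition

end SphereNetwork

end

/-! Ind + Nul is the largest dimension of a subspace of the form domain W on which the index form is
nonpositive (`negDim_add_radDim`). This one number, `nonposDim`, behaves better than its two
summands. It is additive over form-orthogonal direct sums (`nonposDim_sup`), and it does not change
when W is replaced by the form-orthogonal, inside W, of a finite dimensional isotropic subspace
(`nonposDim_orthIn`). It takes values in `ℕ∞`, so neither finiteness of the index nor regularity of
weak null functions has to be proved.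

Let K be the space of functions on N that restrict to an element of J_0^0 on every piece. It is
finite dimensional, because it consists of solutions of linear ODEs, and isotropic by Green's
formula. If φ in W is form-orthogonal to K, Green's formula shows that the trace of φ on each Q̃_i
is orthogonal to D_i (`comp_trace_mem`), which is exactly the condition for an L-extension to exist.
Subtracting the glued L-extension of the trace on P̄ leaves a function that vanishes at all boundary
endpoints of the pieces. Hence the orthogonal of K in W is the direct sum of the spaces
W^{1,2}_{0,1}(N_i) and of the glued extensions of V̄_1 (`orthIn_piecesJ`). These summands are
mutually orthogonal. On the first the form splits over the pieces; on the glued extensions it is ⟨T̄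
g, h⟩ (`bform_glueExt`). So T̄ is symmetric, and the spectral theorem identifies the last
contribution with Ind(T̄) + Nul(T̄) (`nonposDim_of_isSymmetric`).

The L-extension comes from a Fredholm alternative in finite dimension (`exists_of_boundary_data`):
the solutions of Lu = 0 have two free data per curve, as many as there are ends, and the conditions
"trace in A, conormal in Aᗮ" are self-adjoint. Uniqueness holds because the difference of two
extensions is an admissible test function in its own orthogonality condition. -/

noncomputable section

namespace SphereNetwork

/-! ### Linear first order systems on [0,1]: existence, uniqueness, smoothness. -/

section LinearODE

/-- Truncation of a real number to `[-R, R]`. -/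
def clamp (R x : ℝ) : ℝ := max (-R) (min R x)

lemma clamp_eq_self {R x : ℝ} (h : |x| ≤ R) : clamp R x = x := by
  obtain ⟨h1, h2⟩ := abs_le.1 h
  rw [clamp, min_eq_right h2, max_eq_right h1]

lemma abs_clamp_le {R : ℝ} (hR : 0 ≤ R) (x : ℝ) : |clamp R x| ≤ R :=
  abs_le.2 ⟨le_max_left _ _, max_le (by linarith) (min_le_left _ _)⟩

lemma abs_clamp_sub_le (R x y : ℝ) : |clamp R x - clamp R y| ≤ |x - y| := by
  refine (abs_max_sub_max_le_max _ _ _ _).trans ?_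
  simp only [sub_self, abs_zero]
  refine max_le (abs_nonneg _) ((abs_min_sub_min_le_max _ _ _ _).trans ?_)
  simp

lemma clamp_zero {R : ℝ} (hR : 0 ≤ R) : clamp R 0 = 0 := clamp_eq_self (by simpa)

lemma abs_clamp_le_abs {R : ℝ} (hR : 0 ≤ R) (x : ℝ) : |clamp R x| ≤ |x| := by
  simpa [clamp_zero hR] using abs_clamp_sub_le R x 0

lemma exists_abs_le_of_continuousOn {p : ℝ → ℝ} (hp : ContinuousOn p (Icc 0 1)) :
    ∃ C, ∀ t ∈ Icc (0 : ℝ) 1, |p t| ≤ C :=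
  isCompact_Icc.exists_bound_of_continuousOn hp

/-- Existence for a linear system of two first order equations on `[0,1]`. -/
lemma exists_linear_system {p q : ℝ → ℝ} (hp : ContinuousOn p (Icc 0 1))
    (hq : ContinuousOn q (Icc 0 1)) (a b : ℝ) :
    ∃ u v : ℝ → ℝ, u 0 = a ∧ v 0 = b ∧
      (∀ t ∈ Icc (0 : ℝ) 1, HasDerivWithinAt u (p t * v t) (Icc 0 1) t) ∧
      ∀ t ∈ Icc (0 : ℝ) 1, HasDerivWithinAt v (q t * u t) (Icc 0 1) t := by
  obtain ⟨C₁, h₁⟩ := exists_abs_le_of_continuousOn hp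
  obtain ⟨C₂, h₂⟩ := exists_abs_le_of_continuousOn hq
  set C : ℝ := max (max C₁ C₂) 0 with hC
  have hC0 : 0 ≤ C := le_max_right _ _
  have hpC : ∀ t ∈ Icc (0 : ℝ) 1, |p t| ≤ C := fun t ht =>
    (h₁ t ht).trans ((le_max_left _ _).trans (le_max_left _ _))
  have hqC : ∀ t ∈ Icc (0 : ℝ) 1, |q t| ≤ C := fun t ht =>
    (h₂ t ht).trans ((le_max_right _ _).trans (le_max_left _ _))
  -- R is the Gronwall bound for the linear system at time 1. Truncating the unknowns at R makes the
  -- field globally bounded by C * R, so a Picard ball of radius C * R serves the whole unit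
  -- interval.
  set R : ℝ := ‖((a, b) : ℝ × ℝ)‖ * Real.exp C with hR
  have hR0 : 0 ≤ R := by positivity
  let f : ℝ → ℝ × ℝ → ℝ × ℝ := fun t x => (p t * clamp R x.2, q t * clamp R x.1)
  have hPL : IsPicardLindelof f (⟨0, by simp⟩ : Icc (0 : ℝ) 1) (a, b)
      ⟨C * R, by positivity⟩ 0 ⟨C * R, by positivity⟩ ⟨C, hC0⟩ := by
    refine ⟨fun t ht => LipschitzOnWith.of_dist_le_mul fun x _ y _ => ?_, fun x _ => ?_,
      fun t ht x _ => ?_, ?_⟩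
    · rw [Prod.dist_eq, Prod.dist_eq]
      simp only [f, Real.dist_eq, ← mul_sub, abs_mul]
      refine max_le ?_ ?_
      · exact mul_le_mul (hpC t ht) ((abs_clamp_sub_le _ _ _).trans (le_max_right _ _))
          (abs_nonneg _) hC0
      · exact mul_le_mul (hqC t ht) ((abs_clamp_sub_le _ _ _).trans (le_max_left _ _))
          (abs_nonneg _) hC0
    · exact (hp.mul continuousOn_const).prodMk (hq.mul continuousOn_const)
    · rw [Prod.norm_def]
      simp only [f, Real.norm_eq_abs, abs_mul]
      exact max_le (mul_le_mul (hpC t ht) (abs_clamp_le hR0 _) (abs_nonneg _) hC0)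
        (mul_le_mul (hqC t ht) (abs_clamp_le hR0 _) (abs_nonneg _) hC0)
    · simp
  obtain ⟨x, hx0, hx⟩ := hPL.exists_eq_forall_mem_Icc_hasDerivWithinAt₀
  change x 0 = (a, b) at hx0
  -- Truncation does not increase absolute values, so Gronwall applies to the truncated system too.
  -- The solution then never leaves the range where the truncation is inactive.
  have hxR : ∀ t ∈ Icc (0 : ℝ) 1, ‖x t‖ ≤ R := by
    intro t ht
    have h := norm_le_gronwallBound_of_norm_deriv_right_le (f := x) (f' := fun t => f t (x t))
      (δ := ‖((a, b) : ℝ × ℝ)‖) (K := C) (ε := 0) (a := 0) (b := 1)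
      (fun t ht => (hx t ht).continuousWithinAt)
      (fun t ht => (hx t (Ico_subset_Icc_self ht)).mono_of_mem_nhdsWithin
        (Icc_mem_nhdsGE_of_mem ht)) (by rw [hx0])
      (fun t ht => ?_) t ht
    · rw [gronwallBound_ε0] at h
      refine h.trans (mul_le_mul_of_nonneg_left (Real.exp_le_exp.2 ?_) (norm_nonneg _))
      nlinarith [ht.1, ht.2]
    · have ht' := Ico_subset_Icc_self ht
      rw [add_zero, Prod.norm_def, Prod.norm_def]
      simp only [f, Real.norm_eq_abs, abs_mul]
      exact max_le
        (mul_le_mul (hpC t ht') ((abs_clamp_le_abs hR0 _).trans (le_max_right _ _))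
          (abs_nonneg _) hC0)
        (mul_le_mul (hqC t ht') ((abs_clamp_le_abs hR0 _).trans (le_max_left _ _))
          (abs_nonneg _) hC0)
  refine ⟨fun t => (x t).1, fun t => (x t).2, by simp [hx0], by simp [hx0], fun t ht => ?_,
    fun t ht => ?_⟩
  · have h := (hasFDerivWithinAt_fst (𝕜 := ℝ) (E := ℝ) (F := ℝ) (s := univ)
      (p := x t)).comp_hasDerivWithinAt t (hx t ht) (mapsTo_univ _ _)
    have e : clamp R (x t).2 = (x t).2 := clamp_eq_self ((norm_snd_le _).trans (hxR t ht))
    simpa [f, e, Function.comp_def] using h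
  · have h := (hasFDerivWithinAt_snd (𝕜 := ℝ) (E := ℝ) (F := ℝ) (s := univ)
      (p := x t)).comp_hasDerivWithinAt t (hx t ht) (mapsTo_univ _ _)
    have e : clamp R (x t).1 = (x t).1 := clamp_eq_self ((norm_fst_le _).trans (hxR t ht))
    simpa [f, e, Function.comp_def] using h

/-- Uniqueness for a linear system of two first order equations on `[0,1]`. -/
lemma linear_system_eq_zero {p q u v : ℝ → ℝ} (hp : ContinuousOn p (Icc 0 1))
    (hq : ContinuousOn q (Icc 0 1)) (hu0 : u 0 = 0) (hv0 : v 0 = 0)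
    (hu : ∀ t ∈ Icc (0 : ℝ) 1, HasDerivWithinAt u (p t * v t) (Icc 0 1) t)
    (hv : ∀ t ∈ Icc (0 : ℝ) 1, HasDerivWithinAt v (q t * u t) (Icc 0 1) t) :
    ∀ t ∈ Icc (0 : ℝ) 1, u t = 0 := by
  obtain ⟨C₁, h₁⟩ := exists_abs_le_of_continuousOn hp
  obtain ⟨C₂, h₂⟩ := exists_abs_le_of_continuousOn hq
  have hx : ∀ t ∈ Icc (0 : ℝ) 1,
      HasDerivWithinAt (fun t => (u t, v t)) (p t * v t, q t * u t) (Icc 0 1) t :=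
    fun t ht => (hu t ht).prodMk (hv t ht)
  intro t ht
  have h := eq_zero_of_abs_deriv_le_mul_abs_self_of_eq_zero_right (f := fun t => (u t, v t))
    (f' := fun t => (p t * v t, q t * u t)) (K := max C₁ C₂) (a := 0) (b := 1)
    (fun t ht => (hx t ht).continuousWithinAt)
    (fun t ht => (hx t (Ico_subset_Icc_self ht)).mono_of_mem_nhdsWithin
        (Icc_mem_nhdsGE_of_mem ht)) (by simp [hu0, hv0]) (fun t ht => ?_) t ht
  · exact congrArg Prod.fst h
  · have ht' := Ico_subset_Icc_self ht
    have hC0 : 0 ≤ max C₁ C₂ := ((abs_nonneg _).trans (h₁ t ht')).trans (le_max_left _ _)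
    rw [Prod.norm_def, Prod.norm_def]
    simp only [Real.norm_eq_abs, abs_mul]
    exact max_le (mul_le_mul ((h₁ t ht').trans (le_max_left _ _)) (le_max_right _ _)
        (abs_nonneg _) hC0)
      (mul_le_mul ((h₂ t ht').trans (le_max_right _ _)) (le_max_left _ _) (abs_nonneg _) hC0)

/-- Solutions of a linear system with smooth coefficients are smooth. -/
lemma linear_system_contDiffOn {p q u v : ℝ → ℝ} (hp : ContDiffOn ℝ ∞ p (Icc 0 1))
    (hq : ContDiffOn ℝ ∞ q (Icc 0 1))
    (hu : ∀ t ∈ Icc (0 : ℝ) 1, HasDerivWithinAt u (p t * v t) (Icc 0 1) t)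
    (hv : ∀ t ∈ Icc (0 : ℝ) 1, HasDerivWithinAt v (q t * u t) (Icc 0 1) t) :
    ContDiffOn ℝ ∞ u (Icc 0 1) ∧ ContDiffOn ℝ ∞ v (Icc 0 1) := by
  have hU := uniqueDiffOn_Icc (zero_lt_one' ℝ)
  -- Bootstrapping: the equations express each derivative through the other unknown, so both gain
  -- one order at a time.
  have key : ∀ n : ℕ, ContDiffOn ℝ n u (Icc 0 1) ∧ ContDiffOn ℝ n v (Icc 0 1) := by
    intro n
    induction n with
    | zero =>
      simp only [Nat.cast_zero, contDiffOn_zero]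
      exact ⟨fun t ht => (hu t ht).continuousWithinAt, fun t ht => (hv t ht).continuousWithinAt⟩
    | succ n ih =>
      have hn : ((n : ℕ∞) : WithTop ℕ∞) ≤ ∞ := by exact_mod_cast le_top
      have hpn : ContDiffOn ℝ n p (Icc 0 1) := hp.of_le hn
      have hqn : ContDiffOn ℝ n q (Icc 0 1) := hq.of_le hn
      push_cast
      refine ⟨(contDiffOn_succ_iff_derivWithin hU).2 ⟨fun t ht => (hu t ht).differentiableWithinAt,
        by simp, (hpn.mul ih.2).congr fun t ht => (hu t ht).derivWithin (hU t ht)⟩,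
        (contDiffOn_succ_iff_derivWithin hU).2 ⟨fun t ht => (hv t ht).differentiableWithinAt,
        by simp, (hqn.mul ih.1).congr fun t ht => (hv t ht).derivWithin (hU t ht)⟩⟩
  exact ⟨contDiffOn_infty.2 fun n => (key n).1, contDiffOn_infty.2 fun n => (key n).2⟩

end LinearODE

/-! ### Solutions of Lf = 0 on one curve, as a system for f and its arc length derivative. -/

lemma lift_apply {F : Type*} [NormedAddCommGroup F] [NormedSpace ℝ F] (f : unitInterval → F)
    (t : unitInterval) : lift f t = f t := IccExtend_val _ _ _

lemma lift_restrict_eqOn (u : ℝ → ℝ) : EqOn (lift fun t : unitInterval => u t) u (Icc 0 1) :=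
  fun t ht => lift_apply (fun t : unitInterval => u t) ⟨t, ht⟩

lemma der_restrict {u : ℝ → ℝ} {u' t : ℝ} (ht : t ∈ Icc (0 : ℝ) 1)
    (hu : HasDerivWithinAt u u' (Icc 0 1) t) : der (fun t : unitInterval => u t) t = u' := by
  rw [der, derivWithin_congr (lift_restrict_eqOn u) (lift_restrict_eqOn u ht)]
  exact hu.derivWithin (uniqueDiffOn_Icc zero_lt_one t ht)

namespace Curve

variable (c : Curve)

lemma speed_pos {t : ℝ} (ht : t ∈ Icc (0 : ℝ) 1) : 0 < c.speed t :=
  norm_pos_iff.2 (c.regular ⟨t, ht⟩)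

/-- The arc length derivative of a solution, and the equation it satisfies. -/
lemma hasDerivWithinAt_of_solution {d f : unitInterval → ℝ} (hf : IsSmooth f)
    (h : ∀ t : unitInterval, c.laplacian f t + d t * f t = 0) {t : ℝ} (ht : t ∈ Icc (0 : ℝ) 1) :
    HasDerivWithinAt (lift f) (c.speed t * (der f t / c.speed t)) (Icc 0 1) t ∧
    HasDerivWithinAt (fun s => der f s / c.speed s) (-(lift d t * c.speed t) * lift f t)
      (Icc 0 1) t := by
  refine ⟨?_, ?_⟩
  · rw [mul_div_cancel₀ _ (c.speed_ne_zero ht)]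
    exact (hf.differentiableWithinAt ht).hasDerivWithinAt
  · have hd : DifferentiableWithinAt ℝ (fun s => der f s / c.speed s) (Icc 0 1) t :=
      ((hf.der_contDiffOn.div c.speed_contDiffOn fun s hs => c.speed_ne_zero hs).differentiableOn
        (by simp)) t ht
    have e := h ⟨t, ht⟩
    have e' : derivWithin (fun s => der f s / c.speed s) (Icc 0 1) t =
        -(lift d t * c.speed t) * lift f t := by
      rw [lift_apply d ⟨t, ht⟩, lift_apply f ⟨t, ht⟩]
      have hs := c.speed_ne_zero ht
      simp only [laplacian] at e
      field_simp at e
      linear_combination e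
    exact e' ▸ hd.hasDerivWithinAt

/-- A solution of `Lf = 0` with zero initial data vanishes. -/
lemma solution_eq_zero {d f : unitInterval → ℝ} (hd : IsSmooth d) (hf : IsSmooth f)
    (h : ∀ t : unitInterval, c.laplacian f t + d t * f t = 0) (h0 : f 0 = 0)
    (h1 : der f 0 / c.speed 0 = 0) : f = 0 := by
  funext t
  have := linear_system_eq_zero (u := lift f) (v := fun s => der f s / c.speed s)
    c.speed_contDiffOn.continuousOn (hd.continuousOn.mul c.speed_contDiffOn.continuousOn).neg
    ((lift_apply f 0).trans h0) h1
    (fun t ht => (c.hasDerivWithinAt_of_solution hf h ht).1)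
    (fun t ht => (c.hasDerivWithinAt_of_solution hf h ht).2) t t.2
  rwa [lift_apply] at this

/-- Solutions of `Lf = 0` exist for all initial data. -/
lemma exists_solution {d : unitInterval → ℝ} (hd : IsSmooth d) (a b : ℝ) :
    ∃ f : unitInterval → ℝ, IsSmooth f ∧ (∀ t : unitInterval, c.laplacian f t + d t * f t = 0) ∧
      f 0 = a ∧ der f 0 / c.speed 0 = b := by
  have hq : ContDiffOn ℝ ∞ (fun t => -(lift d t * c.speed t)) (Icc 0 1) :=
    (ContDiffOn.mul hd c.speed_contDiffOn).neg
  obtain ⟨u, v, hu0, hv0, hu, hv⟩ :=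
    exists_linear_system c.speed_contDiffOn.continuousOn hq.continuousOn a b
  obtain ⟨hus, hvs⟩ := linear_system_contDiffOn c.speed_contDiffOn hq hu hv
  have hder : ∀ t ∈ Icc (0 : ℝ) 1, der (fun t : unitInterval => u t) t / c.speed t = v t := by
    intro t ht
    rw [der_restrict ht (hu t ht), mul_div_cancel_left₀ _ (c.speed_ne_zero ht)]
  refine ⟨fun t => u t, hus.congr (lift_restrict_eqOn u), fun t => ?_, hu0, ?_⟩
  · have e : derivWithin (fun s => der (fun t : unitInterval => u t) s / c.speed s) (Icc 0 1) t =
        -(lift d t * c.speed t) * u t := by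
      rw [derivWithin_congr hder (hder t t.2)]
      exact (hv t t.2).derivWithin (uniqueDiffOn_Icc zero_lt_one t t.2)
    have hs := c.speed_ne_zero t.2
    rw [laplacian, e, lift_apply]
    field_simp
    ring
  · rw [hder 0 (by simp), hv0]

end Curve

/-! ### Symmetric bilinear forms in arbitrary dimension: index, radical, nonpositive subspaces. -/

section QuadraticForm

/-- The dimension of a subspace, as an extended natural number. -/
def edim {V : Type} [AddCommGroup V] [Module ℝ V] (S : Submodule ℝ V) : ℕ∞ :=
  Cardinal.toENat (Module.rank ℝ S)

variable {V V' : Type} [AddCommGroup V] [Module ℝ V] [AddCommGroup V'] [Module ℝ V']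

lemma edim_mono {S T : Submodule ℝ V} (h : S ≤ T) : edim S ≤ edim T :=
  OrderHomClass.mono Cardinal.toENat (Submodule.rank_mono h)

lemma edim_eq_finrank (S : Submodule ℝ V) [FiniteDimensional ℝ S] :
    edim S = (Module.finrank ℝ S : ℕ∞) := by
  rw [edim, ← Module.finrank_eq_rank, Cardinal.toENat_nat]

lemma finiteDimensional_of_edim_ne_top {S : Submodule ℝ V} (h : edim S ≠ ⊤) :
    FiniteDimensional ℝ S := by
  refine Module.rank_lt_aleph0_iff.1 ?_
  by_contra hc
  exact h (Cardinal.toENat_eq_top.2 (not_lt.1 hc))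

lemma edim_sup {S T : Submodule ℝ V} (h : Disjoint S T) : edim (S ⊔ T) = edim S + edim T := by
  have e := Submodule.rank_sup_add_rank_inf_eq S T
  rw [h.eq_bot, rank_bot, add_zero] at e
  rw [edim, e, map_add]
  rfl

lemma edim_bot : edim (⊥ : Submodule ℝ V) = 0 := by simp [edim]

lemma edim_map {f : V →ₗ[ℝ] V'} (hf : Function.Injective f) (S : Submodule ℝ V) :
    edim (S.map f) = edim S := by
  rw [edim, edim, (Submodule.equivMapOfInjective f hf S).rank_eq]

/-- A subspace that meets `Z` trivially and lies in `N ⊔ Z` is at most as large as `N`. -/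
lemma edim_le_of_disjoint {S N Z : Submodule ℝ V} (h : Disjoint S Z) (hS : S ≤ N ⊔ Z) :
    edim S ≤ edim N := by
  have hinj : Function.Injective (Z.mkQ.domRestrict S) := by
    rw [← LinearMap.ker_eq_bot, LinearMap.ker_domRestrict, Submodule.ker_mkQ,
      ← Submodule.disjoint_iff_comap_eq_bot]
    exact h
  refine OrderHomClass.mono Cardinal.toENat ?_
  rw [← rank_range_of_injective _ hinj, LinearMap.range_domRestrict]
  have hle : S.map Z.mkQ ≤ N.map Z.mkQ := by
    refine (Submodule.map_mono hS).trans ?_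
    rw [Submodule.map_sup, Submodule.mkQ_map_self, sup_bot_eq]
  exact (Submodule.rank_mono hle).trans (rank_map_le _ _)

variable (B : LinearMap.BilinForm ℝ V) (W : Submodule ℝ V)

/-- The maximal dimension of a subspace of `W` on which `B` is negative definite. -/
def negDim : ℕ∞ :=
  ⨆ S : {S : Submodule ℝ V // S ≤ W ∧ ∀ x ∈ S, x ≠ 0 → B x x < 0}, edim S.1

/-- The maximal dimension of a subspace of `W` that is `B`-orthogonal to `W`. -/
def radDim : ℕ∞ :=
  ⨆ S : {S : Submodule ℝ V // S ≤ W ∧ ∀ x ∈ S, ∀ y ∈ W, B x y = 0}, edim S.1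

/-- The maximal dimension of a subspace of `W` on which `B` is nonpositive. -/
def nonposDim : ℕ∞ :=
  ⨆ S : {S : Submodule ℝ V // S ≤ W ∧ ∀ x ∈ S, B x x ≤ 0}, edim S.1

/-- The vectors of `W` that are `B`-orthogonal to `K`. -/
def orthIn (K : Submodule ℝ V) : Submodule ℝ V where
  carrier := {x | x ∈ W ∧ ∀ y ∈ K, B x y = 0}
  zero_mem' := ⟨W.zero_mem, by simp⟩
  add_mem' := by
    rintro x y ⟨h1, h2⟩ ⟨k1, k2⟩
    exact ⟨W.add_mem h1 k1, fun z hz => by simp [h2 z hz, k2 z hz]⟩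
  smul_mem' := by
    rintro a x ⟨h1, h2⟩
    exact ⟨W.smul_mem a h1, fun z hz => by simp [h2 z hz]⟩

lemma orthIn_le (K : Submodule ℝ V) : orthIn B W K ≤ W := fun _ hx => hx.1

variable {B W}

lemma edim_le_nonposDim {S : Submodule ℝ V} (h : S ≤ W) (hS : ∀ x ∈ S, B x x ≤ 0) :
    edim S ≤ nonposDim B W :=
  le_iSup (fun S : {S : Submodule ℝ V // S ≤ W ∧ ∀ x ∈ S, B x x ≤ 0} => edim S.1) ⟨S, h, hS⟩

lemma edim_le_negDim {S : Submodule ℝ V} (h : S ≤ W) (hS : ∀ x ∈ S, x ≠ 0 → B x x < 0) :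
    edim S ≤ negDim B W :=
  le_iSup (fun S : {S : Submodule ℝ V // S ≤ W ∧ ∀ x ∈ S, x ≠ 0 → B x x < 0} => edim S.1)
    ⟨S, h, hS⟩

lemma nonposDim_mono {W' : Submodule ℝ V} (h : W ≤ W') : nonposDim B W ≤ nonposDim B W' :=
  iSup_le fun S => edim_le_nonposDim (S.2.1.trans h) S.2.2

/-- The radical is itself the largest competitor, so the supremum is attained. -/
lemma radDim_eq : radDim B W = edim (orthIn B W W) :=
  le_antisymm (iSup_le fun S => edim_mono fun x hx => ⟨S.2.1 hx, S.2.2 x hx⟩)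
    (le_iSup (fun S : {S : Submodule ℝ V // S ≤ W ∧ ∀ x ∈ S, ∀ y ∈ W, B x y = 0} => edim S.1)
      ⟨orthIn B W W, orthIn_le B W W, fun _ hx => hx.2⟩)

lemma negDim_le_nonposDim : negDim B W ≤ nonposDim B W :=
  iSup_le fun S => edim_le_nonposDim S.2.1 fun x hx => by
    rcases eq_or_ne x 0 with rfl | h
    · simp
    · exact (S.2.2 x hx h).le

lemma nonposDim_map {B' : LinearMap.BilinForm ℝ V'} {f : V →ₗ[ℝ] V'} (hf : Function.Injective f)
    (h : ∀ x y, B' (f x) (f y) = B x y) : nonposDim B' (W.map f) = nonposDim B W := by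
  refine le_antisymm (iSup_le fun S => ?_) (iSup_le fun S => ?_)
  · have e : (S.1.comap f).map f = S.1 := by
      rw [Submodule.map_comap_eq, inf_eq_right]
      exact S.2.1.trans LinearMap.map_le_range
    rw [← e, edim_map hf]
    refine edim_le_nonposDim (fun x hx => ?_) fun x hx => h x x ▸ S.2.2 _ hx
    obtain ⟨y, hy, hxy⟩ := S.2.1 hx
    exact hf hxy ▸ hy
  · rw [← edim_map hf]
    refine edim_le_nonposDim (Submodule.map_mono S.2.1) ?_
    rintro _ ⟨x, hx, rfl⟩
    exact h x x ▸ S.2.2 x hx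

lemma disjoint_of_nonpos_of_pos {N Z : Submodule ℝ V} (hN : ∀ x ∈ N, B x x ≤ 0)
    (hZ : ∀ x ∈ Z, x ≠ 0 → 0 < B x x) : Disjoint N Z := by
  rw [Submodule.disjoint_def]
  intro x hx hx'
  by_contra h0
  exact absurd (hN x hx) (not_le.2 (hZ x hx' h0))

/-- A nonpositive subspace meets Z only in 0, so it embeds in the quotient by Z, where W is covered
by N. No orthogonality between N and Z is needed. All later computations of `nonposDim` pass through
this criterion. -/
lemma nonposDim_eq_of_splitting {N Z : Submodule ℝ V} (hNW : N ≤ W)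
    (hN : ∀ x ∈ N, B x x ≤ 0) (hZ : ∀ x ∈ Z, x ≠ 0 → 0 < B x x) (h : W ≤ N ⊔ Z) :
    nonposDim B W = edim N :=
  le_antisymm (iSup_le fun S =>
    edim_le_of_disjoint (disjoint_of_nonpos_of_pos S.2.2 hZ) (S.2.1.trans h))
    (edim_le_nonposDim hNW hN)

lemma form_add_self (hB : ∀ x y, B x y = B y x) (x y : V) :
    B (x + y) (x + y) = B x x + 2 * B x y + B y y := by
  simp only [map_add, LinearMap.add_apply, hB y x]
  ring

/-- A null vector of a nonnegative form is in its radical. -/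
lemma form_eq_zero_of_nonneg (hB : ∀ x y, B x y = B y x) {S : Submodule ℝ V}
    (hS : ∀ x ∈ S, 0 ≤ B x x) {x y : V} (hx : x ∈ S) (hy : y ∈ S) (h0 : B x x = 0) :
    B x y = 0 := by
  by_contra hne
  -- As B x x = 0, the form at c • x + y is 2 c B x y + B y y. This choice of c makes it -1.
  have h := hS _ (S.add_mem (S.smul_mem (-(B y y + 1) / (2 * B x y)) hx) hy)
  rw [form_add_self hB] at h
  simp only [map_smul, LinearMap.smul_apply, smul_eq_mul, h0, mul_zero, zero_add] at h
  have e : 2 * (-(B y y + 1) / (2 * B x y) * B x y) = -(B y y + 1) := by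
    field_simp
  rw [e] at h
  linarith

lemma form_eq_zero_of_nonpos (hB : ∀ x y, B x y = B y x) {S : Submodule ℝ V}
    (hS : ∀ x ∈ S, B x x ≤ 0) {x y : V} (hx : x ∈ S) (hy : y ∈ S) (h0 : B x x = 0) :
    B x y = 0 := by
  have := form_eq_zero_of_nonneg (B := -B) (fun x y => by simp [hB x y]) (S := S)
    (fun x hx => by simpa using hS x hx) hx hy (by simpa using h0)
  simpa using this

/-- Projection onto a finite dimensional subspace without null vectors. -/
lemma exists_mem_forall_form_sub_eq_zero {K : Submodule ℝ V} [FiniteDimensional ℝ K]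
    (hK : ∀ x ∈ K, B x x = 0 → x = 0) (x : V) : ∃ w ∈ K, ∀ y ∈ K, B (x - w) y = 0 := by
  -- Without null vectors the form is nondegenerate on K, so the map to the dual is injective, hence
  -- onto by dimension. The projection is the preimage of B x restricted to K.
  let φ : K →ₗ[ℝ] Module.Dual ℝ K := B.domRestrict₁₂ K K
  have hφ : Function.Injective φ := by
    rw [injective_iff_map_eq_zero]
    exact fun s hs => Subtype.ext (hK s s.2 (LinearMap.congr_fun hs s))
  obtain ⟨s, hs⟩ := ((LinearMap.injective_iff_surjective_of_finrank_eq_finrank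
    Subspace.dual_finrank_eq.symm).1 hφ) ((B x).domRestrict K)
  refine ⟨s, s.2, fun y hy => ?_⟩
  have e : B s y = B x y := LinearMap.congr_fun hs ⟨y, hy⟩
  simp [e]

/-- Intersect a complement of R with T; the modular law gives the sum. -/
lemma exists_relative_complement {R T : Submodule ℝ V} (h : R ≤ T) :
    ∃ Z ≤ T, R ⊔ Z = T ∧ Disjoint R Z := by
  obtain ⟨C, hC⟩ := Submodule.exists_isCompl R
  refine ⟨C ⊓ T, inf_le_right, ?_, hC.disjoint.mono_right inf_le_left⟩
  rw [← sup_inf_assoc_of_le C h, hC.sup_eq_top, top_inf_eq]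

/-- If the index is finite, there is a splitting of `W` into a maximal negative part, the radical
and a positive part. -/
lemma exists_splitting (hB : ∀ x y, B x y = B y x) (h : negDim B W ≠ ⊤) :
    ∃ S Z : Submodule ℝ V, S ≤ W ∧ Z ≤ W ∧ (∀ x ∈ S, x ≠ 0 → B x x < 0) ∧
      (∀ x ∈ Z, x ≠ 0 → 0 < B x x) ∧ edim S = negDim B W ∧ W ≤ (S ⊔ orthIn B W W) ⊔ Z := by
  have : Nonempty {S : Submodule ℝ V // S ≤ W ∧ ∀ x ∈ S, x ≠ 0 → B x x < 0} :=
    ⟨⊥, bot_le, fun x hx h0 => absurd (Submodule.mem_bot ℝ |>.1 hx) h0⟩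
  -- A finite supremum in `ℕ∞` is attained, so there is a negative subspace of maximal dimension.
  obtain ⟨⟨S, hSW, hS⟩, hSe⟩ := ENat.exists_eq_iSup_of_lt_top (lt_top_iff_ne_top.2 h)
  change edim S = negDim B W at hSe
  have : FiniteDimensional ℝ S := finiteDimensional_of_edim_ne_top (hSe ▸ h)
  have hSd : Disjoint S (orthIn B W S) := by
    rw [Submodule.disjoint_def]
    intro x hx hx'
    by_contra h0
    exact (hS x hx h0).ne (hx'.2 x hx)
  have hdec : W ≤ S ⊔ orthIn B W S := by
    intro x hx
    obtain ⟨s, hs, h⟩ := exists_mem_forall_form_sub_eq_zero (B := B) (K := S)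
      (fun y hy hy0 => not_imp_comm.1 (hS y hy) hy0.not_lt) x
    rw [← add_sub_cancel s x]
    exact Submodule.add_mem_sup hs ⟨W.sub_mem hx (hSW hs), h⟩
  -- Maximality of S: a negative vector orthogonal to S could be added to it.
  have hT : ∀ x ∈ orthIn B W S, 0 ≤ B x x := by
    intro x hx
    by_contra hneg
    push Not at hneg
    have hx0 : x ≠ 0 := by
      rintro rfl
      simp at hneg
    have hd : Disjoint S (Submodule.span ℝ {x}) :=
      hSd.mono_right ((Submodule.span_singleton_le_iff_mem _ _).2 hx)
    have hle := edim_le_negDim (B := B) (W := W) (S := S ⊔ Submodule.span ℝ {x})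
      (sup_le hSW ((Submodule.span_singleton_le_iff_mem _ _).2 hx.1)) (by
        intro y hy hy0
        obtain ⟨s, hs, z, hz, rfl⟩ := Submodule.mem_sup.1 hy
        obtain ⟨a, rfl⟩ := Submodule.mem_span_singleton.1 hz
        have e : B s (a • x) = 0 := by simp [hB s x, hx.2 s hs]
        rw [form_add_self hB, e]
        simp only [map_smul, LinearMap.smul_apply, smul_eq_mul]
        rcases eq_or_ne s 0 with rfl | hs0
        · have ha : a ≠ 0 := by
            rintro rfl
            simp at hy0
          have := mul_pos_of_neg_of_neg hneg (neg_neg_of_pos (sq_pos_of_ne_zero ha))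
          simp only [map_zero]
          nlinarith
        · have := hS s hs hs0
          nlinarith [mul_nonneg (sq_nonneg a) (neg_nonneg.2 hneg.le)])
    rw [edim_sup hd, ← hSe, edim_eq_finrank S, edim_eq_finrank, finrank_span_singleton hx0] at hle
    norm_cast at hle
    omega
  have hRT : orthIn B W W ≤ orthIn B W S := fun x hx => ⟨hx.1, fun y hy => hx.2 y (hSW hy)⟩
  -- The form is nonnegative on the orthogonal of S, so a null vector there is orthogonal to all of
  -- it. It is also orthogonal to S, hence lies in the radical of W. A complement Z of the radical
  -- therefore has no nonzero null vector.
  obtain ⟨Z, hZT, hRZ, hRd⟩ := exists_relative_complement hRT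
  refine ⟨S, Z, hSW, hZT.trans (orthIn_le _ _ _), hS, fun x hx hx0 => ?_, hSe, ?_⟩
  · refine lt_of_le_of_ne (hT x (hZT hx)) fun h0 => hx0 ?_
    refine Submodule.disjoint_def.1 hRd x ⟨(hZT hx).1, fun y hy => ?_⟩ hx
    obtain ⟨s, hs, z, hz, rfl⟩ := Submodule.mem_sup.1 (hdec hy)
    rw [map_add, (hZT hx).2 s hs, form_eq_zero_of_nonneg hB hT (hZT hx) hz h0.symm, add_zero]
  · rwa [sup_assoc, hRZ]

lemma nonpos_sup_orthIn (hB : ∀ x y, B x y = B y x) {S : Submodule ℝ V} (hSW : S ≤ W)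
    (hS : ∀ x ∈ S, x ≠ 0 → B x x < 0) : ∀ x ∈ S ⊔ orthIn B W W, B x x ≤ 0 := by
  intro x hx
  obtain ⟨s, hs, r, hr, rfl⟩ := Submodule.mem_sup.1 hx
  rw [form_add_self hB, hB s r, hr.2 s (hSW hs), hr.2 r hr.1]
  rcases eq_or_ne s 0 with rfl | hs0
  · simp
  · linarith [hS s hs hs0]

/-- A negative subspace plus the radical is a nonpositive direct sum, which gives one inequality.
For the other, if the index is finite, a maximal negative subspace plus the radical has a positive
complement in W. If the index is infinite, both sides are. -/
theorem negDim_add_radDim (hB : ∀ x y, B x y = B y x) :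
    negDim B W + radDim B W = nonposDim B W := by
  rw [radDim_eq]
  refine le_antisymm ?_ ?_
  · have : Nonempty {S : Submodule ℝ V // S ≤ W ∧ ∀ x ∈ S, x ≠ 0 → B x x < 0} :=
      ⟨⊥, bot_le, fun x hx h0 => absurd (Submodule.mem_bot ℝ |>.1 hx) h0⟩
    rw [negDim, ENat.iSup_add]
    refine iSup_le fun S => ?_
    have hd : Disjoint S.1 (orthIn B W W) := by
      rw [Submodule.disjoint_def]
      intro x hx hx'
      by_contra h0
      exact (S.2.2 x hx h0).ne (hx'.2 x hx'.1)
    rw [← edim_sup hd]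
    exact edim_le_nonposDim (sup_le S.2.1 (orthIn_le _ _ _)) (nonpos_sup_orthIn hB S.2.1 S.2.2)
  · by_cases h : negDim B W = ⊤
    · simp [h]
    obtain ⟨S, Z, hSW, -, hS, hZ, hSe, hW⟩ := exists_splitting hB h
    rw [nonposDim_eq_of_splitting (sup_le hSW (orthIn_le _ _ _)) (nonpos_sup_orthIn hB hSW hS)
      hZ hW, ← hSe, edim_sup]
    rw [Submodule.disjoint_def]
    intro x hx hx'
    by_contra h0
    exact (hS x hx h0).ne (hx'.2 x hx'.1)

lemma exists_nonpos_pos_splitting (hB : ∀ x y, B x y = B y x) (h : nonposDim B W ≠ ⊤) :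
    ∃ N Z : Submodule ℝ V, N ≤ W ∧ Z ≤ W ∧ (∀ x ∈ N, B x x ≤ 0) ∧
      (∀ x ∈ Z, x ≠ 0 → 0 < B x x) ∧ W ≤ N ⊔ Z := by
  obtain ⟨S, Z, hSW, hZW, hS, hZ, -, hW⟩ :=
    exists_splitting hB (ne_top_of_le_ne_top h negDim_le_nonposDim)
  exact ⟨S ⊔ orthIn B W W, Z, sup_le hSW (orthIn_le _ _ _), hZW, nonpos_sup_orthIn hB hSW hS,
    hZ, hW⟩

/-- Additivity for orthogonal sums. -/
theorem nonposDim_sup (hB : ∀ x y, B x y = B y x) {W₁ W₂ : Submodule ℝ V} (hd : Disjoint W₁ W₂)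
    (ho : ∀ x ∈ W₁, ∀ y ∈ W₂, B x y = 0) :
    nonposDim B (W₁ ⊔ W₂) = nonposDim B W₁ + nonposDim B W₂ := by
  -- If one summand is infinite, monotonicity suffices. Otherwise both spaces split into a
  -- nonpositive and a positive part, and by orthogonality the splittings add up.
  by_cases h₁ : nonposDim B W₁ = ⊤
  · rw [h₁, top_add, eq_top_iff, ← h₁]
    exact nonposDim_mono le_sup_left
  by_cases h₂ : nonposDim B W₂ = ⊤
  · rw [h₂, add_top, eq_top_iff, ← h₂]
    exact nonposDim_mono le_sup_right
  obtain ⟨N₁, Z₁, hN₁W, hZ₁W, hN₁, hZ₁, hW₁⟩ := exists_nonpos_pos_splitting hB h₁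
  obtain ⟨N₂, Z₂, hN₂W, hZ₂W, hN₂, hZ₂, hW₂⟩ := exists_nonpos_pos_splitting hB h₂
  rw [nonposDim_eq_of_splitting hN₁W hN₁ hZ₁ hW₁, nonposDim_eq_of_splitting hN₂W hN₂ hZ₂ hW₂,
    ← edim_sup (hd.mono hN₁W hN₂W)]
  refine nonposDim_eq_of_splitting (Z := Z₁ ⊔ Z₂) (sup_le_sup hN₁W hN₂W) ?_ ?_ ?_
  · intro x hx
    obtain ⟨a, ha, b, hb, rfl⟩ := Submodule.mem_sup.1 hx
    rw [form_add_self hB, ho a (hN₁W ha) b (hN₂W hb)]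
    linarith [hN₁ a ha, hN₂ b hb]
  · intro x hx hx0
    obtain ⟨a, ha, b, hb, rfl⟩ := Submodule.mem_sup.1 hx
    rw [form_add_self hB, ho a (hZ₁W ha) b (hZ₂W hb)]
    rcases eq_or_ne a 0 with rfl | ha0
    · have := hZ₂ b hb (by simpa using hx0)
      simpa using this
    · rcases eq_or_ne b 0 with rfl | hb0
      · simpa using hZ₁ a ha ha0
      · linarith [hZ₁ a ha ha0, hZ₂ b hb hb0]
  · refine sup_le (hW₁.trans ?_) (hW₂.trans ?_)
    · exact sup_le_sup le_sup_left le_sup_left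
    · exact sup_le_sup le_sup_right le_sup_right

/-- Passing to the orthogonal complement of a finite dimensional isotropic subspace does not
change the maximal dimension of nonpositive subspaces. -/
theorem nonposDim_orthIn (hB : ∀ x y, B x y = B y x) {K : Submodule ℝ V} [FiniteDimensional ℝ K]
    (hKW : K ≤ W) (hK : ∀ x ∈ K, ∀ y ∈ K, B x y = 0) :
    nonposDim B (orthIn B W K) = nonposDim B W := by
  refine le_antisymm (nonposDim_mono (orthIn_le _ _ _)) (iSup_le ?_)
  rintro ⟨P, hPW, hP⟩
  -- The nonpositive subspace P is replaced by (P ⊓ orthIn B W K) ⊔ C, which lies in the orthogonal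
  -- of K, is still nonpositive, and is at least as large.
  obtain ⟨C, hCK, hC, hCd⟩ := exists_relative_complement (inf_le_right : P ⊓ K ≤ K)
  have : FiniteDimensional ℝ C := Submodule.finiteDimensional_of_le hCK
  have hd : Disjoint (P ⊓ orthIn B W K) C := by
    rw [Submodule.disjoint_def] at hCd ⊢
    exact fun x hx hx' => hCd x ⟨hx.1, hCK hx'⟩ hx'
  let f : P →ₗ[ℝ] Module.Dual ℝ C := B.domRestrict₁₂ P C
  -- Orthogonality to C is enough for elements of P: vectors of P ⊓ K are null in P, where the form
  -- is nonpositive, so they are orthogonal to P anyway. Thus passing to the orthogonal of K costs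
  -- at most dim C.
  have hker : (LinearMap.ker f).map P.subtype ≤ P ⊓ orthIn B W K := by
    rintro _ ⟨x, hx, rfl⟩
    refine ⟨x.2, hPW x.2, fun y hy => ?_⟩
    rw [← hC] at hy
    obtain ⟨k, hk, c, hc, rfl⟩ := Submodule.mem_sup.1 hy
    have e : B x c = 0 := LinearMap.congr_fun (LinearMap.mem_ker.1 hx) ⟨c, hc⟩
    change B x (k + c) = 0
    rw [map_add, e, add_zero, hB]
    exact form_eq_zero_of_nonpos hB hP hk.1 x.2 (hK k hk.2 k hk.2)
  have hdim : edim P ≤ edim (P ⊓ orthIn B W K) + edim C := by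
    have h1 : Module.rank ℝ (LinearMap.range f) ≤ Module.rank ℝ C := by
      refine (Submodule.rank_le _).trans ?_
      rw [← Module.finrank_eq_rank, ← Module.finrank_eq_rank, Subspace.dual_finrank_eq]
    have h2 : Module.rank ℝ (LinearMap.ker f) ≤ Module.rank ℝ ↥(P ⊓ orthIn B W K) := by
      rw [(Submodule.equivMapOfInjective P.subtype P.injective_subtype _).rank_eq]
      exact Submodule.rank_mono hker
    have h3 := f.rank_range_add_rank_ker
    rw [edim, ← h3, map_add, add_comm]
    exact add_le_add (OrderHomClass.mono Cardinal.toENat h2)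
      (OrderHomClass.mono Cardinal.toENat h1)
  rw [← edim_sup hd] at hdim
  refine hdim.trans (edim_le_nonposDim (sup_le inf_le_right fun x hx =>
    ⟨hKW (hCK hx), hK x (hCK hx)⟩) fun x hx => ?_)
  obtain ⟨a, ha, c, hc, rfl⟩ := Submodule.mem_sup.1 hx
  rw [form_add_self hB, ha.2.2 c (hCK hc), hK c (hCK hc) c (hCK hc)]
  linarith [hP a ha.1]

end QuadraticForm

/-! ### Nonpositive subspaces of symmetric operators in finite dimension. -/

section Symmetric

variable {E : Type} [NormedAddCommGroup E] [InnerProductSpace ℝ E] {T : E →ₗ[ℝ] E}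

/-- The quadratic form of a symmetric operator on a sum of eigenvectors. -/
lemma exists_eigenvector_expansion (hT : T.IsSymmetric) {p : ℝ → Prop} {x : E}
    (hx : x ∈ ⨆ σ : {σ : ℝ // p σ}, Module.End.eigenspace T σ) :
    ∃ f : {σ : ℝ // p σ} →₀ E, x = ∑ σ ∈ f.support, f σ ∧
      ⟪T x, x⟫_ℝ = ∑ σ ∈ f.support, (σ : ℝ) * ‖f σ‖ ^ 2 := by
  obtain ⟨f, hf, hfx⟩ := (Submodule.mem_iSup_iff_exists_finsupp _ _).1 hx
  refine ⟨f, hfx.symm, ?_⟩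
  have hE : ∀ σ, T (f σ) = (σ : ℝ) • f σ := fun σ => Module.End.mem_eigenspace_iff.1 (hf σ)
  rw [← hfx, Finsupp.sum, map_sum, sum_inner]
  refine Finset.sum_congr rfl fun σ hσ => ?_
  rw [inner_sum, Finset.sum_eq_single σ, hE, inner_smul_left, real_inner_self_eq_norm_sq]
  · simp
  · intro τ _ hne
    have h := hT.orthogonalFamily_eigenspaces (i := (σ : ℝ)) (j := (τ : ℝ))
      (fun h => hne (Subtype.ext h).symm) ⟨f σ, hf σ⟩ ⟨f τ, hf τ⟩
    simp only [Submodule.coe_subtypeₗᵢ, Submodule.subtype_apply]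
      at h
    rw [hE, inner_smul_left, h, mul_zero]
  · intro h
    exact absurd hσ h

/-- The maximal dimension of a nonpositive subspace of a symmetric operator, by eigenspaces. -/
theorem nonposDim_of_isSymmetric [FiniteDimensional ℝ E] (hT : T.IsSymmetric)
    {B : LinearMap.BilinForm ℝ E} (hB : ∀ x y, B x y = ⟪T x, y⟫_ℝ) :
    nonposDim B ⊤ =
      (Module.finrank ℝ ↥(⨆ σ : {σ : ℝ // σ < 0}, Module.End.eigenspace T σ) : ℕ∞) +
        (Module.finrank ℝ ↥(Module.End.eigenspace T 0) : ℕ∞) := by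
  have hd : Disjoint (⨆ σ : {σ : ℝ // σ < 0}, Module.End.eigenspace T σ)
      (Module.End.eigenspace T 0) := by
    refine ((Module.End.eigenspaces_iSupIndep T) 0).symm.mono_left (iSup_le fun σ => ?_)
    exact le_iSup₂_of_le σ.1 σ.2.ne le_rfl
  rw [← edim_eq_finrank, ← edim_eq_finrank, ← edim_sup hd]
  -- Eigenvalues ≤ 0 against eigenvalues > 0; the spectral theorem says that together they span.
  refine nonposDim_eq_of_splitting
    (Z := ⨆ σ : {σ : ℝ // 0 < σ}, Module.End.eigenspace T σ) le_top ?_ ?_ ?_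
  · intro x hx
    have hx' : x ∈ ⨆ σ : {σ : ℝ // σ ≤ 0}, Module.End.eigenspace T σ := by
      refine (sup_le (iSup_le fun σ => ?_) ?_ :
        _ ≤ ⨆ σ : {σ : ℝ // σ ≤ 0}, Module.End.eigenspace T σ) hx
      · exact le_iSup_of_le (⟨σ.1, σ.2.le⟩ : {σ : ℝ // σ ≤ 0}) le_rfl
      · exact le_iSup_of_le (⟨0, le_rfl⟩ : {σ : ℝ // σ ≤ 0}) le_rfl
    obtain ⟨f, -, hf⟩ := exists_eigenvector_expansion hT hx'
    rw [hB, hf]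
    exact Finset.sum_nonpos fun σ _ => mul_nonpos_of_nonpos_of_nonneg σ.2 (sq_nonneg _)
  · intro x hx hx0
    obtain ⟨f, hfx, hf⟩ := exists_eigenvector_expansion hT hx
    rw [hB, hf]
    refine Finset.sum_pos (fun σ hσ => ?_) ?_
    · have := norm_pos_iff.2 (Finsupp.mem_support_iff.1 hσ)
      exact mul_pos σ.2 (by positivity)
    · by_contra h
      rw [Finset.not_nonempty_iff_eq_empty] at h
      rw [h, Finset.sum_empty] at hfx
      exact hx0 hfx
  · rw [← Submodule.orthogonal_eq_bot_iff.1 hT.orthogonalComplement_iSup_eigenspaces_eq_bot]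
    refine iSup_le fun σ => ?_
    rcases lt_trichotomy σ 0 with h | rfl | h
    · exact le_sup_of_le_left (le_sup_of_le_left
        (le_iSup_of_le (⟨σ, h⟩ : {σ : ℝ // σ < 0}) le_rfl))
    · exact le_sup_of_le_left le_sup_right
    · exact le_sup_of_le_right (le_iSup_of_le (⟨σ, h⟩ : {σ : ℝ // 0 < σ}) le_rfl)

end Symmetric

/-! ### The index form, Green's formula and the L² product on one curve. -/

lemma IsSmooth.continuousOn_der {f : unitInterval → ℝ} (hf : IsSmooth f) :
    ContinuousOn (der f) (Icc 0 1) := hf.der_contDiffOn.continuousOn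

lemma IsSmooth.isW12 {f : unitInterval → ℝ} (hf : IsSmooth f) : IsW12 f := by
  refine ⟨?_, ?_⟩
  · refine ContDiffOn.absolutelyContinuousOnInterval ?_
    rw [uIcc_of_le zero_le_one]
    exact ContDiffOn.of_le hf (by exact_mod_cast le_top)
  · obtain ⟨C, hC⟩ := exists_abs_le_of_continuousOn hf.continuousOn_der
    exact MemLp.of_bound (hf.continuousOn_der.aestronglyMeasurable measurableSet_Icc) C
      ((ae_restrict_iff' measurableSet_Icc).2 (Filter.Eventually.of_forall hC))

lemma IsW12.continuousOn {f : unitInterval → ℝ} (hf : IsW12 f) :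
    ContinuousOn (lift f) (Icc 0 1) := by
  have := hf.1.continuousOn
  rwa [uIcc_of_le zero_le_one] at this

lemma intervalIntegrable_of_integrableOn {f : ℝ → ℝ} (hf : IntegrableOn f (Icc 0 1)) :
    IntervalIntegrable f volume 0 1 := by
  rw [intervalIntegrable_iff_integrableOn_Icc_of_le zero_le_one]
  exact hf

namespace Curve

variable (c : Curve)

/-- The index form on a single curve. -/
def form (d f g : unitInterval → ℝ) : ℝ :=
  ∫ t in (0 : ℝ)..1, (der f t * der g t / c.speed t - lift d t * lift f t * lift g t * c.speed t)

variable {c} {d f f' g : unitInterval → ℝ}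

lemma continuousOn_mul_speed (hd : IsSmooth d) (hf : IsW12 f) (hg : IsW12 g) :
    ContinuousOn (fun t => lift d t * lift f t * lift g t * c.speed t) (Icc 0 1) :=
  ((ContinuousOn.mul (ContDiffOn.continuousOn hd) hf.continuousOn).mul hg.continuousOn).mul
    c.speed_contDiffOn.continuousOn

lemma form_integrable (hd : IsSmooth d) (hf : IsW12 f) (hg : IsW12 g) :
    IntervalIntegrable
      (fun t => der f t * der g t / c.speed t - lift d t * lift f t * lift g t * c.speed t)
      volume 0 1 := by
  refine intervalIntegrable_of_integrableOn (Integrable.sub ?_ ?_)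
  · have h : IntegrableOn (fun t => der f t * der g t) (Icc 0 1) := hf.2.integrable_mul hg.2
    have hs : ContinuousOn (fun t => (c.speed t)⁻¹) (Icc 0 1) :=
      c.speed_contDiffOn.continuousOn.inv₀ fun t ht => c.speed_ne_zero ht
    exact h.mul_continuousOn hs isCompact_Icc
  · exact (continuousOn_mul_speed hd hf hg).integrableOn_compact isCompact_Icc

lemma form_symm : c.form d f g = c.form d g f := by
  unfold form
  congr 1
  funext t
  ring

/-- The derivative is additive only almost everywhere, and the integrals split only when they
converge. Both use W^{1,2}; on arbitrary functions the form is not bilinear. -/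
lemma form_add_left (hd : IsSmooth d) (hf : IsW12 f) (hf' : IsW12 f') (hg : IsW12 g) :
    c.form d (f + f') g = c.form d f g + c.form d f' g := by
  unfold form
  rw [← intervalIntegral.integral_add (form_integrable hd hf hg) (form_integrable hd hf' hg)]
  refine intervalIntegral.integral_congr_ae_restrict ?_
  rw [uIoc_of_le zero_le_one]
  filter_upwards [ae_mono (Measure.restrict_mono_set volume Ioc_subset_Icc_self)
    (hf.der_add hf')] with t ht
  simp only [ht, lift_add, Pi.add_apply]
  ring

lemma form_smul_left (a : ℝ) : c.form d (a • f) g = a * c.form d f g := by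
  unfold form
  rw [← intervalIntegral.integral_const_mul]
  congr 1
  funext t
  simp only [der_smul, lift_smul, Pi.smul_apply, smul_eq_mul]
  ring

lemma form_zero_left : c.form d 0 g = 0 := by
  simpa using form_smul_left (c := c) (d := d) (f := 0) (g := g) 0

/-- Green's formula on a curve. -/
lemma form_eq_of_solution (hf : IsSmooth f)
    (h : ∀ t : unitInterval, c.laplacian f t + d t * f t = 0) (hg : IsW12 g) :
    c.form d f g = c.conormal f true * g (endParam true) +
      c.conormal f false * g (endParam false) := by
  set k : ℝ → ℝ := fun s => der f s / c.speed s with hk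
  have hks : ContDiffOn ℝ ∞ k (Icc 0 1) :=
    hf.der_contDiffOn.div c.speed_contDiffOn fun s hs => c.speed_ne_zero hs
  have hkac : AbsolutelyContinuousOnInterval k 0 1 := by
    refine ContDiffOn.absolutelyContinuousOnInterval ?_
    rw [uIcc_of_le zero_le_one]
    exact hks.of_le (by exact_mod_cast le_top)
  -- Integration by parts for absolutely continuous functions, applied to the arc length derivative
  -- of f and to g.
  have key := hkac.integral_deriv_mul_eq_sub hg.1
  have hnhds : ∀ t ∈ Ioo (0 : ℝ) 1, Icc (0 : ℝ) 1 ∈ nhds t := fun t ht => Icc_mem_nhds ht.1 ht.2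
  have e : c.form d f g = ∫ t in (0 : ℝ)..1, deriv k t * lift g t + k t * deriv (lift g) t := by
    refine intervalIntegral.integral_congr_Ioo_of_le zero_le_one fun t ht => ?_
    have h1 : deriv k t = -(lift d t * c.speed t) * lift f t :=
      ((c.hasDerivWithinAt_of_solution hf h (Ioo_subset_Icc_self ht)).2.hasDerivAt
        (hnhds t ht)).deriv
    have h2 : der g t = deriv (lift g) t := derivWithin_of_mem_nhds (hnhds t ht)
    change der f t * der g t / c.speed t - _ = deriv k t * lift g t + k t * deriv (lift g) t
    rw [h1, h2, hk]
    ring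
  rw [e, key]
  have h0 : lift g 0 = g 0 := lift_apply g 0
  have h1 : lift g 1 = g 1 := lift_apply g 1
  rw [h0, h1]
  simp only [conormal, endSign, endParam, hk, if_true, Bool.false_eq_true, if_false,
    Icc.coe_zero, Icc.coe_one]
  ring

/-- The `L²` inner product on a single curve. -/
def innerL2 (c : Curve) (f g : unitInterval → ℝ) : ℝ :=
  ∫ t in (0 : ℝ)..1, lift f t * lift g t * c.speed t

lemma innerL2_continuousOn (hf : ContinuousOn (lift f) (Icc 0 1))
    (hg : ContinuousOn (lift g) (Icc 0 1)) :
    ContinuousOn (fun t => lift f t * lift g t * c.speed t) (Icc 0 1) :=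
  (hf.mul hg).mul c.speed_contDiffOn.continuousOn

lemma innerL2_add_left (hf : ContinuousOn (lift f) (Icc 0 1))
    (hf' : ContinuousOn (lift f') (Icc 0 1)) (hg : ContinuousOn (lift g) (Icc 0 1)) :
    c.innerL2 (f + f') g = c.innerL2 f g + c.innerL2 f' g := by
  unfold innerL2
  rw [← intervalIntegral.integral_add]
  · congr 1
    funext t
    simp only [lift_add, Pi.add_apply]
    ring
  · exact (innerL2_continuousOn hf hg).intervalIntegrable_of_Icc zero_le_one
  · exact (innerL2_continuousOn hf' hg).intervalIntegrable_of_Icc zero_le_one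

lemma innerL2_smul_left (a : ℝ) : c.innerL2 (a • f) g = a * c.innerL2 f g := by
  unfold innerL2
  rw [← intervalIntegral.integral_const_mul]
  congr 1
  funext t
  simp only [lift_smul, Pi.smul_apply, smul_eq_mul]
  ring

lemma innerL2_symm : c.innerL2 f g = c.innerL2 g f := by
  unfold innerL2
  congr 1
  funext t
  ring

lemma innerL2_self_nonneg : 0 ≤ c.innerL2 f f :=
  intervalIntegral.integral_nonneg zero_le_one fun _ ht =>
    mul_nonneg (mul_self_nonneg _) (c.speed_pos ht).le

lemma eq_zero_of_innerL2_self (hf : ContinuousOn (lift f) (Icc 0 1)) (h : c.innerL2 f f = 0) :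
    f = 0 := by
  by_contra hne
  obtain ⟨t, ht⟩ := Function.ne_iff.1 hne
  refine (intervalIntegral.integral_pos zero_lt_one (innerL2_continuousOn (c := c) hf hf)
    (fun s hs => mul_nonneg (mul_self_nonneg _) (c.speed_pos (Ioc_subset_Icc_self hs)).le)
    ⟨t, t.2, ?_⟩).ne' h
  rw [lift_apply]
  exact mul_pos (mul_self_pos.2 ht) (c.speed_pos t.2)

end Curve

/-! ### A Fredholm alternative on boundary data. -/

section Fredholm

variable {S U : Type} [AddCommGroup S] [Module ℝ S] [FiniteDimensional ℝ S]
  [NormedAddCommGroup U] [InnerProductSpace ℝ U] [FiniteDimensional ℝ U]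

/-- The Fredholm alternative for self-adjoint boundary conditions, in terms of boundary data. -/
theorem exists_of_boundary_data (tr cn : S →ₗ[ℝ] U)
    (hsymm : ∀ u v, ⟪cn u, tr v⟫_ℝ = ⟪cn v, tr u⟫_ℝ)
    (hinj : ∀ u, tr u = 0 → cn u = 0 → u = 0)
    (hdim : Module.finrank ℝ S = Module.finrank ℝ U) (A : Submodule ℝ U) (g : U)
    (hg : ∀ v, tr v ∈ A → cn v ∈ Aᗮ → ⟪g, cn v⟫_ℝ = 0) :
    ∃ u, tr u - g ∈ A ∧ cn u ∈ Aᗮ := by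
  let P : U →ₗ[ℝ] U := A.starProjection
  have hPA : ∀ x, P x ∈ A := fun x => A.starProjection_apply_mem x
  have hPo : ∀ x, x - P x ∈ Aᗮ := fun x => A.sub_starProjection_mem_orthogonal x
  -- Both homogeneous conditions, tr u ∈ A and cn u ∈ Aᗮ, are encoded in one map into U; the two
  -- parts lie in complementary orthogonal spaces, so they vanish separately.
  let b : S →ₗ[ℝ] U := tr - P ∘ₗ tr + P ∘ₗ cn
  have hb : ∀ u, b u = (tr u - P (tr u)) + P (cn u) := fun u => rfl
  have hsplit : ∀ {x y : U}, x ∈ Aᗮ → y ∈ A → x + y = 0 → x = 0 ∧ y = 0 := by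
    intro x y hx hy h
    have hxA : x ∈ A := by
      rw [eq_neg_of_add_eq_zero_left h]
      exact A.neg_mem hy
    have hx0 : x = 0 := by simpa using Submodule.inner_right_of_mem_orthogonal hxA hx
    refine ⟨hx0, ?_⟩
    rwa [hx0, zero_add] at h
  have hmemA : ∀ {x : U}, x - P x = 0 → x ∈ A := by
    intro x hx
    rw [sub_eq_zero.1 hx]
    exact hPA x
  have hmemo : ∀ {x : U}, P x = 0 → x ∈ Aᗮ := by
    intro x hx
    simpa [hx] using hPo x
  have hker : ∀ u, b u = 0 → tr u ∈ A ∧ cn u ∈ Aᗮ := by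
    intro u hu
    obtain ⟨h1, h2⟩ := hsplit (hPo _) (hPA _) ((hb u).symm.trans hu)
    exact ⟨hmemA h1, hmemo h2⟩
  -- The range of c will be the cokernel of b. The pairing of b u with c v reduces to ⟪tr u, cn v⟫ -
  -- ⟪cn u, tr v⟫, which is 0 by symmetry.
  let c : LinearMap.ker b →ₗ[ℝ] U := (cn - tr).domRestrict (LinearMap.ker b)
  have hc : ∀ v, c v = cn v - tr v := fun v => rfl
  have hcinj : Function.Injective c := by
    rw [injective_iff_map_eq_zero]
    intro v hv
    obtain ⟨h1, h2⟩ := hker v v.2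
    rw [hc, sub_eq_add_neg] at hv
    obtain ⟨h3, h4⟩ := hsplit h2 (A.neg_mem h1) hv
    exact Subtype.ext (hinj v (neg_eq_zero.1 h4) h3)
  have hle : LinearMap.range b ≤ (LinearMap.range c)ᗮ := by
    rintro _ ⟨u, rfl⟩
    rw [Submodule.mem_orthogonal']
    rintro _ ⟨v, rfl⟩
    obtain ⟨h1, h2⟩ := hker v v.2
    have e1 : ⟪tr u, cn v⟫_ℝ = ⟪tr u - P (tr u), cn v⟫_ℝ := by
      rw [inner_sub_left, Submodule.inner_right_of_mem_orthogonal (hPA _) h2, sub_zero]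
    have e2 : ⟪cn u, tr v⟫_ℝ = ⟪P (cn u), tr v⟫_ℝ := by
      have := Submodule.inner_left_of_mem_orthogonal h1 (hPo (cn u))
      rw [inner_sub_left] at this
      linarith
    have e3 : ⟪tr u - P (tr u), tr v⟫_ℝ = 0 := Submodule.inner_left_of_mem_orthogonal h1 (hPo _)
    have e4 : ⟪P (cn u), cn v⟫_ℝ = 0 := Submodule.inner_right_of_mem_orthogonal (hPA _) h2
    rw [hb, hc, inner_add_left, inner_sub_right, inner_sub_right, e3, e4, ← e1, ← e2, hsymm u v,
      real_inner_comm]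
    ring
  -- Here dim S = dim U enters: by injectivity of c, both dimensions are dim U - dim ker b.
  have hfin : Module.finrank ℝ (LinearMap.range b) = Module.finrank ℝ (LinearMap.range c)ᗮ := by
    have h1 := b.finrank_range_add_finrank_ker
    have h2 := (LinearMap.range c).finrank_add_finrank_orthogonal
    have h3 := LinearMap.finrank_range_of_inj hcinj
    omega
  have heq := Submodule.eq_of_le_of_finrank_eq hle hfin
  have hgm : g - P g ∈ (LinearMap.range c)ᗮ := by
    rw [Submodule.mem_orthogonal']
    rintro _ ⟨v, rfl⟩
    obtain ⟨h1, h2⟩ := hker v v.2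
    rw [hc, inner_sub_right, Submodule.inner_left_of_mem_orthogonal h1 (hPo g), inner_sub_left,
      hg v h1 h2, Submodule.inner_right_of_mem_orthogonal (hPA _) h2]
    ring
  rw [← heq] at hgm
  obtain ⟨u, hu⟩ := hgm
  rw [hb] at hu
  have h0 : ((tr u - g) - P (tr u - g)) + P (cn u) = 0 := by
    rw [map_sub, ← sub_eq_zero.2 hu]
    abel
  obtain ⟨h1, h2⟩ := hsplit (hPo _) (hPA _) h0
  exact ⟨u, hmemA h1, hmemo h2⟩

end Fredholm

/-! ### The index form on a network and the space of solutions, in terms of end values. -/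

namespace Network

variable (N : Network)

/-- The tuples of `W^{1,2}` functions. -/
def sobolev : Submodule ℝ N.Fn where
  carrier := {φ | ∀ i, IsW12 (φ i)}
  zero_mem' := fun _ => IsW12.zero
  add_mem' := fun h k i => (h i).add (k i)
  smul_mem' := fun a _ h i => (h i).smul a

lemma form_eq_sum (d φ ψ : N.Fn) : N.form d φ ψ = ∑ i, (N.curve i).form (d i) (φ i) (ψ i) := rfl

lemma form_symm (d φ ψ : N.Fn) : N.form d φ ψ = N.form d ψ φ :=
  Finset.sum_congr rfl fun _ _ => Curve.form_symm

lemma form_add_left {d φ φ' ψ : N.Fn} (hd : ∀ i, IsSmooth (d i)) (hφ : φ ∈ N.sobolev)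
    (hφ' : φ' ∈ N.sobolev) (hψ : ψ ∈ N.sobolev) :
    N.form d (φ + φ') ψ = N.form d φ ψ + N.form d φ' ψ := by
  simp only [form_eq_sum, ← Finset.sum_add_distrib]
  exact Finset.sum_congr rfl fun i _ => Curve.form_add_left (hd i) (hφ i) (hφ' i) (hψ i)

lemma form_smul_left (d : N.Fn) (a : ℝ) (φ ψ : N.Fn) :
    N.form d (a • φ) ψ = a * N.form d φ ψ := by
  simp only [form_eq_sum, Finset.mul_sum]
  exact Finset.sum_congr rfl fun i _ => Curve.form_smul_left a

/-- The index form as a bilinear form. -/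
def bform {d : N.Fn} (hd : ∀ i, IsSmooth (d i)) : LinearMap.BilinForm ℝ N.sobolev :=
  LinearMap.mk₂ ℝ (fun φ ψ => N.form d φ ψ)
    (fun φ φ' ψ => N.form_add_left hd φ.2 φ'.2 ψ.2)
    (fun a φ ψ => N.form_smul_left d a φ ψ)
    (fun φ ψ ψ' => by
      rw [form_symm, form_symm _ _ _ ψ.1, form_symm _ _ _ ψ'.1]
      exact N.form_add_left hd ψ.2 ψ'.2 φ.2)
    (fun a φ ψ => by
      rw [form_symm, form_symm _ _ _ ψ.1]
      exact N.form_smul_left d a ψ φ)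

lemma bform_symm {d : N.Fn} (hd : ∀ i, IsSmooth (d i)) (φ ψ : N.sobolev) :
    N.bform hd φ ψ = N.bform hd ψ φ := N.form_symm d φ ψ

lemma W_le_sobolev : N.W ≤ N.sobolev := fun _ h => h.1

/-- The space `W^{1,2}_{0,1}(N)` inside the space of all tuples of `W^{1,2}` functions. -/
def sobolevW : Submodule ℝ N.sobolev := N.W.comap N.sobolev.subtype

lemma edim_comap_subtype {V : Type} [AddCommGroup V] [Module ℝ V] {S H : Submodule ℝ V}
    (h : S ≤ H) : edim (S.comap H.subtype) = edim S := by
  rw [← edim_map H.injective_subtype, Submodule.map_comap_subtype, inf_eq_right.2 h]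

/-- The index is defined by subspaces of all tuples of functions, where the form is not bilinear.
Every competitor lies in the Sobolev tuples, so nothing is lost by passing to them. -/
lemma index_eq_negDim {d : N.Fn} (hd : ∀ i, IsSmooth (d i)) :
    N.index d = negDim (N.bform hd) N.sobolevW := by
  refine le_antisymm (iSup_le fun S => ?_) (iSup_le fun S => ?_)
  · change edim S.1 ≤ _
    rw [← edim_comap_subtype (S.2.1.trans N.W_le_sobolev)]
    exact edim_le_negDim (Submodule.comap_mono S.2.1) fun x hx hx0 =>
      S.2.2 x hx fun h => hx0 (Subtype.ext h)
  · rw [← edim_map N.sobolev.injective_subtype]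
    refine le_iSup (fun S : {S : Submodule ℝ N.Fn // S ≤ N.W ∧ ∀ φ ∈ S, φ ≠ 0 →
      N.form d φ φ < 0} => edim S.1) ⟨S.1.map N.sobolev.subtype, Submodule.map_le_iff_le_comap.2
      S.2.1, ?_⟩
    rintro _ ⟨x, hx, rfl⟩ hx0
    exact S.2.2 x hx fun h => hx0 (by simp [h])

lemma nullity_eq_radDim {d : N.Fn} (hd : ∀ i, IsSmooth (d i)) :
    N.nullity d = radDim (N.bform hd) N.sobolevW := by
  refine le_antisymm (iSup_le fun S => ?_) (iSup_le fun S => ?_)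
  · change edim S.1 ≤ _
    rw [← edim_comap_subtype (S.2.1.trans N.W_le_sobolev)]
    exact le_iSup (fun S : {S : Submodule ℝ N.sobolev // S ≤ N.sobolevW ∧
      ∀ x ∈ S, ∀ y ∈ N.sobolevW, N.bform hd x y = 0} => edim S.1)
      ⟨S.1.comap N.sobolev.subtype, Submodule.comap_mono S.2.1, fun x hx y hy => S.2.2 x hx y hy⟩
  · rw [← edim_map N.sobolev.injective_subtype]
    refine le_iSup (fun S : {S : Submodule ℝ N.Fn // S ≤ N.W ∧ ∀ φ ∈ S, ∀ ψ ∈ N.W,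
      N.form d φ ψ = 0} => edim S.1) ⟨S.1.map N.sobolev.subtype, Submodule.map_le_iff_le_comap.2
      S.2.1, ?_⟩
    rintro _ ⟨x, hx, rfl⟩ ψ hψ
    exact S.2.2 x hx ⟨ψ, N.W_le_sobolev hψ⟩ hψ

lemma index_add_nullity {d : N.Fn} (hd : ∀ i, IsSmooth (d i)) :
    N.index d + N.nullity d = nonposDim (N.bform hd) N.sobolevW := by
  rw [N.index_eq_negDim hd, N.nullity_eq_radDim hd, negDim_add_radDim (N.bform_symm hd)]

/-- The Euclidean space of all ends of curves. -/
abbrev Ends := EuclideanSpace ℝ (Fin N.n × Bool)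

/-- The values of a function at all ends. -/
def endTrace : N.Fn →ₗ[ℝ] N.Ends where
  toFun φ := WithLp.toLp 2 fun h => φ h.1 (endParam h.2)
  map_add' _ _ := rfl
  map_smul' _ _ := rfl

/-- The restriction to the ends at `X`. -/
def resEnds (X : Set E3) : N.Ends →ₗ[ℝ] N.V X where
  toFun v := WithLp.toLp 2 fun h => v h.1
  map_add' _ _ := rfl
  map_smul' _ _ := rfl

lemma resEnds_apply (X : Set E3) (v : N.Ends) (h : N.EndsAt X) : N.resEnds X v h = v h.1 := rfl

open Classical in
/-- Extension by zero from the ends at `X`. -/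
def extEnds (X : Set E3) (v : N.V X) : N.Ends :=
  WithLp.toLp 2 fun h => if hx : N.endpoint h ∈ X then v ⟨h, hx⟩ else 0

lemma extEnds_of_mem {X : Set E3} (v : N.V X) {h : Fin N.n × Bool} (hx : N.endpoint h ∈ X) :
    N.extEnds X v h = v ⟨h, hx⟩ := by
  simp [extEnds, hx]

lemma extEnds_of_notMem {X : Set E3} (v : N.V X) {h : Fin N.n × Bool} (hx : N.endpoint h ∉ X) :
    N.extEnds X v h = 0 := by
  simp [extEnds, hx]

lemma inner_ends {ι : Type*} [Fintype ι] (v w : EuclideanSpace ℝ ι) :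
    ⟪v, w⟫_ℝ = ∑ h, v h * w h := by
  simp [PiLp.inner_apply, mul_comm]

/-- Extension by zero is adjoint to restriction. -/
lemma inner_extEnds (X : Set E3) (v : N.V X) (w : N.Ends) :
    ⟪N.extEnds X v, w⟫_ℝ = ⟪v, N.resEnds X w⟫_ℝ := by
  classical
  rw [inner_ends, inner_ends]
  refine (Finset.sum_of_injOn (fun h : N.EndsAt X => h.1) Subtype.val_injective.injOn
    (fun _ _ => Finset.mem_coe.2 (Finset.mem_univ _)) (fun h _ hh => ?_) fun h _ => ?_).symm
  · rw [extEnds_of_notMem, zero_mul]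
    exact fun hx => hh ⟨⟨h, hx⟩, Finset.mem_coe.2 (Finset.mem_univ _), rfl⟩
  · rw [N.extEnds_of_mem v h.2, resEnds_apply]

lemma resEnds_extEnds_of_disjoint {X Y : Set E3} (h : Disjoint X Y) (v : N.V X) :
    N.resEnds Y (N.extEnds X v) = 0 := by
  ext k
  exact N.extEnds_of_notMem v fun hx => disjoint_left.1 h hx k.2

lemma resEnds_extEnds (X : Set E3) (v : N.V X) : N.resEnds X (N.extEnds X v) = v := by
  ext k
  exact N.extEnds_of_mem v k.2

lemma endpoint_mem (h : Fin N.n × Bool) : N.endpoint h ∈ N.P ∪ N.Q := by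
  rw [N.endpoints]
  exact ⟨h.1, h.2, rfl⟩

/-- The end values allowed in `W^{1,2}_{0,1}(N)`. -/
def bdry : Submodule ℝ N.Ends := (N.V1 N.P).comap (N.resEnds N.P) ⊓ LinearMap.ker (N.resEnds N.Q)

lemma mem_W_iff {φ : N.Fn} : φ ∈ N.W ↔ φ ∈ N.sobolev ∧ N.endTrace φ ∈ N.bdry := Iff.rfl

lemma eq_extEnds_of_resEnds_eq_zero {v : N.Ends} (hv : N.resEnds N.Q v = 0) :
    v = N.extEnds N.P (N.resEnds N.P v) := by
  ext h
  rcases N.endpoint_mem h with hx | hx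
  · rw [N.extEnds_of_mem _ hx, resEnds_apply]
  · rw [N.extEnds_of_notMem _ fun hP => disjoint_left.1 N.disjoint_PQ hP hx]
    exact congrArg (fun w : N.V N.Q => w ⟨h, hx⟩) hv

/-- This puts the boundary conditions in the self-adjoint form "trace in A, conormal in Aᗮ" with A =
`bdry`. The values on Q are fixed to 0 in A, so the conormal is free there. -/
lemma mem_bdry_orthogonal {w : N.Ends} : w ∈ N.bdryᗮ ↔ N.resEnds N.P w ∈ N.V2 N.P := by
  rw [V2, Submodule.mem_orthogonal, Submodule.mem_orthogonal]
  constructor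
  · intro h v hv
    rw [← inner_extEnds]
    refine h _ ⟨?_, LinearMap.mem_ker.2 (N.resEnds_extEnds_of_disjoint N.disjoint_PQ v)⟩
    change N.resEnds N.P (N.extEnds N.P v) ∈ N.V1 N.P
    rwa [resEnds_extEnds]
  · rintro h v ⟨hv1, hv2⟩
    rw [N.eq_extEnds_of_resEnds_eq_zero hv2, inner_extEnds]
    exact h _ hv1

/-- All smooth solutions of `Lu = 0`, without boundary conditions. -/
def solutions (d : N.Fn) : Submodule ℝ N.Fn where
  carrier := {u | (∀ i, IsSmooth (u i)) ∧ ∀ i t, N.opL d u i t = 0}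
  zero_mem' := ⟨fun _ => IsSmooth.zero, fun i t => by simp [opL, Curve.laplacian_zero]⟩
  add_mem' := by
    rintro φ ψ ⟨h1, h2⟩ ⟨k1, k2⟩
    refine ⟨fun i => (h1 i).add (k1 i), fun i t => ?_⟩
    have h := h2 i t
    have k := k2 i t
    simp only [opL, Pi.add_apply, Curve.laplacian_add _ (h1 i) (k1 i) t.2] at h k ⊢
    linarith
  smul_mem' := by
    rintro a φ ⟨h1, h2⟩
    refine ⟨fun i => (h1 i).smul a, fun i t => ?_⟩
    have h := h2 i t
    simp only [opL, Pi.smul_apply, Curve.laplacian_smul, smul_eq_mul] at h ⊢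
    linear_combination a * h

lemma solutions_le_sobolev (d : N.Fn) : N.solutions d ≤ N.sobolev :=
  fun _ h i => (h.1 i).isW12

/-- The initial data of a solution. -/
def initialData (d : N.Fn) : N.solutions d →ₗ[ℝ] (Fin N.n × Bool → ℝ) where
  toFun u h := if h.2 then der (u.1 h.1) 0 / (N.curve h.1).speed 0 else u.1 h.1 0
  map_add' u v := by
    funext h
    have e := (u.2.1 h.1).der_add (v.2.1 h.1) (t := 0) (by simp)
    by_cases hb : h.2 <;> simp [hb, e, add_div]
  map_smul' a u := by
    funext h
    by_cases hb : h.2 <;> simp [hb, der_smul, mul_div_assoc]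

lemma initialData_bijective {d : N.Fn} (hd : ∀ i, IsSmooth (d i)) :
    Function.Bijective (N.initialData d) := by
  constructor
  · rw [injective_iff_map_eq_zero]
    intro u hu
    refine Subtype.ext (funext fun i => ?_)
    exact (N.curve i).solution_eq_zero (hd i) (u.2.1 i) (u.2.2 i)
      (by simpa [initialData] using congrFun hu (i, false))
      (by simpa [initialData] using congrFun hu (i, true))
  · intro a
    choose f hf1 hf2 hf3 hf4 using fun i =>
      (N.curve i).exists_solution (hd i) (a (i, false)) (a (i, true))
    refine ⟨⟨f, hf1, hf2⟩, funext ?_⟩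
    rintro ⟨i, b⟩
    cases b <;> simp [initialData, hf3, hf4]

lemma finiteDimensional_solutions {d : N.Fn} (hd : ∀ i, IsSmooth (d i)) :
    FiniteDimensional ℝ (N.solutions d) :=
  Module.Finite.equiv (LinearEquiv.ofBijective _ (N.initialData_bijective hd)).symm

/-- Each curve contributes two initial data and has two ends; this is the index zero condition of
the Fredholm alternative. -/
lemma finrank_solutions {d : N.Fn} (hd : ∀ i, IsSmooth (d i)) :
    Module.finrank ℝ (N.solutions d) = Module.finrank ℝ N.Ends := by
  rw [(LinearEquiv.ofBijective _ (N.initialData_bijective hd)).finrank_eq, finrank_euclideanSpace,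
    Module.finrank_fintype_fun_eq_card]

/-- The outer derivatives of a solution at all ends. -/
def endConormal (d : N.Fn) : N.solutions d →ₗ[ℝ] N.Ends where
  toFun u := WithLp.toLp 2 fun h => (N.curve h.1).conormal (u.1 h.1) h.2
  map_add' u v := by
    ext h
    exact (N.curve h.1).conormal_add (u.2.1 _) (v.2.1 _) _
  map_smul' a u := by
    ext h
    exact (N.curve h.1).conormal_smul a _ _

lemma endConormal_apply {d : N.Fn} (u : N.solutions d) (h : Fin N.n × Bool) :
    N.endConormal d u h = (N.curve h.1).conormal (u.1 h.1) h.2 := rfl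

/-- Green's formula. -/
lemma form_eq_inner {d : N.Fn} (u : N.solutions d) {ψ : N.Fn} (hψ : ψ ∈ N.sobolev) :
    N.form d u ψ = ⟪N.endConormal d u, N.endTrace ψ⟫_ℝ := by
  rw [form_eq_sum, inner_ends, Fintype.sum_prod_type]
  refine Finset.sum_congr rfl fun i _ => ?_
  rw [Fintype.sum_bool]
  exact Curve.form_eq_of_solution (u.2.1 i) (u.2.2 i) (hψ i)

lemma inner_endConormal_symm {d : N.Fn} (u v : N.solutions d) :
    ⟪N.endConormal d u, N.endTrace v⟫_ℝ = ⟪N.endConormal d v, N.endTrace u⟫_ℝ := by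
  rw [← N.form_eq_inner u (N.solutions_le_sobolev d v.2),
    ← N.form_eq_inner v (N.solutions_le_sobolev d u.2), form_symm]

/-- The data at the initial ends alone are full Cauchy data. -/
lemma solution_eq_zero_of_ends {d : N.Fn} (hd : ∀ i, IsSmooth (d i)) {u : N.solutions d}
    (h0 : N.endTrace u = 0) (h1 : N.endConormal d u = 0) : u = 0 := by
  refine Subtype.ext (funext fun i => ?_)
  refine (N.curve i).solution_eq_zero (hd i) (u.2.1 i) (u.2.2 i)
    (congrArg (fun w : N.Ends => w (i, false)) h0) ?_
  have h := congrArg (fun w : N.Ends => w (i, false)) h1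
  simp only [endConormal_apply, Curve.conormal, endSign, endParam, Bool.false_eq_true, if_false,
    Icc.coe_zero, PiLp.zero_apply] at h
  linear_combination -h

lemma mem_J00_iff {d : N.Fn} (u : N.solutions d) :
    u.1 ∈ N.J00 d ↔ N.endTrace u ∈ N.bdry ∧ N.endConormal d u ∈ N.bdryᗮ := by
  rw [mem_bdry_orthogonal]
  constructor
  · rintro ⟨⟨_, _, h3, h4⟩, h5⟩
    exact ⟨⟨h3, h5⟩, h4⟩
  · rintro ⟨⟨h3, h5⟩, h4⟩
    exact ⟨⟨u.2.1, u.2.2, h3, h4⟩, h5⟩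

lemma sol_le_solutions (d : N.Fn) : N.sol d ≤ N.solutions d := fun _ h => ⟨h.1, h.2.1⟩

lemma J00_le_solutions (d : N.Fn) : N.J00 d ≤ N.solutions d :=
  fun _ h => N.sol_le_solutions d h.1

lemma finiteDimensional_J00 {d : N.Fn} (hd : ∀ i, IsSmooth (d i)) :
    FiniteDimensional ℝ (N.J00 d) :=
  have := N.finiteDimensional_solutions hd
  Submodule.finiteDimensional_of_le (N.J00_le_solutions d)

end Network

/-! ### Existence, uniqueness and linearity of the L-extension. -/

namespace Network

variable (N : Network)

lemma innerL2_eq_sum (φ ψ : N.Fn) : N.innerL2 φ ψ = ∑ i, (N.curve i).innerL2 (φ i) (ψ i) := rfl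

lemma innerL2_symm (φ ψ : N.Fn) : N.innerL2 φ ψ = N.innerL2 ψ φ :=
  Finset.sum_congr rfl fun _ _ => Curve.innerL2_symm

lemma innerL2_add_left {φ φ' ψ : N.Fn} (hφ : φ ∈ N.sobolev) (hφ' : φ' ∈ N.sobolev)
    (hψ : ψ ∈ N.sobolev) : N.innerL2 (φ + φ') ψ = N.innerL2 φ ψ + N.innerL2 φ' ψ := by
  simp only [innerL2_eq_sum, ← Finset.sum_add_distrib]
  exact Finset.sum_congr rfl fun i _ => Curve.innerL2_add_left (hφ i).continuousOn
    (hφ' i).continuousOn (hψ i).continuousOn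

lemma innerL2_smul_left (a : ℝ) (φ ψ : N.Fn) : N.innerL2 (a • φ) ψ = a * N.innerL2 φ ψ := by
  simp only [innerL2_eq_sum, Finset.mul_sum]
  exact Finset.sum_congr rfl fun i _ => Curve.innerL2_smul_left a

lemma eq_zero_of_innerL2_self {φ : N.Fn} (hφ : φ ∈ N.sobolev) (h : N.innerL2 φ φ = 0) :
    φ = 0 := by
  rw [innerL2_eq_sum, Finset.sum_eq_zero_iff_of_nonneg fun _ _ => Curve.innerL2_self_nonneg] at h
  exact funext fun i => Curve.eq_zero_of_innerL2_self (hφ i).continuousOn (h i (Finset.mem_univ i))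

/-- The `L²` inner product as a bilinear form. -/
def innerL2Form : LinearMap.BilinForm ℝ N.sobolev :=
  LinearMap.mk₂ ℝ (fun φ ψ => N.innerL2 φ ψ)
    (fun φ φ' ψ => N.innerL2_add_left φ.2 φ'.2 ψ.2)
    (fun a φ ψ => N.innerL2_smul_left a φ ψ)
    (fun φ ψ ψ' => by
      rw [innerL2_symm, innerL2_symm _ _ ψ.1, innerL2_symm _ _ ψ'.1]
      exact N.innerL2_add_left ψ.2 ψ'.2 φ.2)
    (fun a φ ψ => by
      rw [innerL2_symm, innerL2_symm _ _ ψ.1]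
      exact N.innerL2_smul_left a ψ φ)

variable {N} {d : N.Fn} {X : Set E3}

lemma IsLExtension.add {g g' : N.V X} {u u' : N.Fn} (h : N.IsLExtension d X g u)
    (h' : N.IsLExtension d X g' u') : N.IsLExtension d X (g + g') (u + u') where
  mem_sol := Submodule.add_mem _ h.mem_sol h'.mem_sol
  trace_eq := by rw [trace_add, h.trace_eq, h'.trace_eq]
  trace_eq_zero := by rw [trace_add, h.trace_eq_zero, h'.trace_eq_zero, add_zero]
  conormal_mem := by
    rw [N.conormal_add h.mem_sol.1 h'.mem_sol.1]
    exact Submodule.add_mem _ h.conormal_mem h'.conormal_mem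
  orthogonal v hv hv0 := by
    rw [N.innerL2_add_left (fun i => (h.mem_sol.1 i).isW12) (fun i => (h'.mem_sol.1 i).isW12)
      (fun i => (hv.1.1 i).isW12), h.orthogonal v hv hv0, h'.orthogonal v hv hv0, add_zero]

lemma IsLExtension.smul (a : ℝ) {g : N.V X} {u : N.Fn} (h : N.IsLExtension d X g u) :
    N.IsLExtension d X (a • g) (a • u) where
  mem_sol := Submodule.smul_mem _ a h.mem_sol
  trace_eq := by rw [trace_smul, h.trace_eq]
  trace_eq_zero := by rw [trace_smul, h.trace_eq_zero, smul_zero]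
  conormal_mem := by
    rw [N.conormal_smul]
    exact Submodule.smul_mem _ a h.conormal_mem
  orthogonal v hv hv0 := by
    rw [N.innerL2_smul_left, h.orthogonal v hv hv0, mul_zero]

lemma trace_eq_zero_of_diff {u : N.Fn} (h : N.trace u X = 0) (h' : N.trace u (N.Q \ X) = 0) :
    N.trace u N.Q = 0 := by
  ext k
  by_cases hk : N.endpoint k.1 ∈ X
  · exact congrArg (fun w : N.V X => w ⟨k.1, hk⟩) h
  · exact congrArg (fun w : N.V (N.Q \ X) => w ⟨k.1, k.2, hk⟩) h'

/-- With zero data u lies in J_0^0, so its conormal on X is both in D(X) and orthogonal to it, hence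
zero. Then u may be tested against itself in L². -/
lemma IsLExtension.eq_zero {u : N.Fn} (h : N.IsLExtension d X 0 u) : u = 0 := by
  have hu : u ∈ N.J00 d := ⟨h.mem_sol, trace_eq_zero_of_diff h.trace_eq h.trace_eq_zero⟩
  have hc : N.conormal u X = 0 := by
    simpa using Submodule.inner_right_of_mem_orthogonal (⟨u, hu, rfl⟩ : N.conormal u X ∈ N.DJ d X)
      h.conormal_mem
  exact N.eq_zero_of_innerL2_self (fun i => (hu.1.1 i).isW12) (h.orthogonal u hu hc)

lemma IsLExtension.unique {g : N.V X} {u u' : N.Fn} (h : N.IsLExtension d X g u)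
    (h' : N.IsLExtension d X g u') : u = u' := by
  have := h.add (h'.smul (-1))
  rw [neg_one_smul, neg_one_smul, add_neg_cancel] at this
  exact add_neg_eq_zero.1 this.eq_zero

/-- Removing the parts of a solution in the null space. -/
lemma exists_isLExtension_of_solution (hd : ∀ i, IsSmooth (d i)) (hX : X ⊆ N.Q) {u : N.Fn}
    (hu : u ∈ N.sol d) (hu0 : N.trace u (N.Q \ X) = 0) :
    ∃ w, N.IsLExtension d X (N.trace u X) w := by
  have hfin := N.finiteDimensional_J00 hd
  have htr : ∀ {v : N.Fn}, v ∈ N.J00 d → ∀ {Y : Set E3}, Y ⊆ N.Q → N.trace v Y = 0 := by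
    intro v hv Y hY
    ext k
    exact congrArg (fun w : N.V N.Q => w ⟨k.1, hY k.2⟩) hv.2
  -- First correction: remove an element of J_0^0 whose conormal is the projection of that of u onto
  -- D(X). Traces on Q are unaffected.
  obtain ⟨v, hv, hve⟩ := (N.DJ d X).starProjection_apply_mem (N.conormal u X)
  have hv' : (-1 : ℝ) • v ∈ N.J00 d := Submodule.smul_mem _ _ hv
  set u₁ : N.Fn := u + (-1 : ℝ) • v with hu₁
  have hu₁s : u₁ ∈ N.sol d := Submodule.add_mem _ hu hv'.1
  have hu₁c : N.conormal u₁ X ∈ (N.DJ d X)ᗮ := by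
    rw [hu₁, N.conormal_add hu.1 hv'.1.1, N.conormal_smul, ← hve, neg_one_smul, ← sub_eq_add_neg]
    exact Submodule.sub_starProjection_mem_orthogonal _
  have hsob : ∀ {w : N.Fn}, w ∈ N.sol d → w ∈ N.sobolev := fun hw i => (hw.1 i).isW12
  let K : Submodule ℝ N.Fn :=
    { carrier := {w | w ∈ N.J00 d ∧ N.conormal w X = 0}
      zero_mem' := ⟨Submodule.zero_mem _, N.conormal_zero X⟩
      add_mem' := fun {a b} ha hb => ⟨Submodule.add_mem _ ha.1 hb.1, by
        rw [N.conormal_add ha.1.1.1 hb.1.1.1, ha.2, hb.2, add_zero]⟩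
      smul_mem' := fun a b hb => ⟨Submodule.smul_mem _ _ hb.1, by
        rw [N.conormal_smul, hb.2, smul_zero]⟩ }
  have hKJ : K ≤ N.J00 d := fun _ hw => hw.1
  have : FiniteDimensional ℝ K := Submodule.finiteDimensional_of_le hKJ
  have : FiniteDimensional ℝ (K.comap N.sobolev.subtype) :=
    Module.Finite.equiv (Submodule.comapSubtypeEquivOfLe
      (fun _ hw => hsob (hKJ hw).1 : K ≤ N.sobolev)).symm
  -- Second correction: remove the L² projection onto the elements of J_0^0 with zero conormal on X,
  -- which leaves the conormal condition intact.
  obtain ⟨w, hw, hwo⟩ := exists_mem_forall_form_sub_eq_zero (B := N.innerL2Form)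
    (K := K.comap N.sobolev.subtype)
    (fun x _ hx => Subtype.ext (N.eq_zero_of_innerL2_self x.2 hx)) ⟨u₁, hsob hu₁s⟩
  have hwc : N.conormal w.1 X = 0 := hw.2
  have hw' : (-1 : ℝ) • w.1 ∈ N.J00 d := Submodule.smul_mem _ _ (hKJ hw)
  refine ⟨u₁ + (-1 : ℝ) • w.1, Submodule.add_mem _ hu₁s hw'.1, ?_, ?_, ?_, fun x hx hx0 => ?_⟩
  · rw [trace_add, hu₁, trace_add, htr hv' hX, htr hw' hX, add_zero, add_zero]
  · rw [trace_add, hu₁, trace_add, htr hv' sdiff_subset, htr hw' sdiff_subset, hu0, add_zero,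
      add_zero]
  · rw [N.conormal_add hu₁s.1 hw'.1.1, N.conormal_smul, hwc, smul_zero, add_zero]
    exact hu₁c
  · have := hwo ⟨x, hsob hx.1⟩ ⟨hx, hx0⟩
    rw [neg_one_smul, ← sub_eq_add_neg]
    exact this

/-- The solvability condition of the Fredholm alternative, for g extended by zero, is orthogonality
to the conormals of J_0^0 on X, that is, g ∈ D(X)ᗮ. The solution is then normalised. -/
theorem exists_isLExtension (hd : ∀ i, IsSmooth (d i)) (hX : X ⊆ N.Q) {g : N.V X}
    (hg : g ∈ (N.DJ d X)ᗮ) : ∃ u, N.IsLExtension d X g u := by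
  have := N.finiteDimensional_solutions hd
  obtain ⟨u, hu, hu'⟩ := exists_of_boundary_data
    (N.endTrace.domRestrict (N.solutions d)) (N.endConormal d) N.inner_endConormal_symm
    (fun u => N.solution_eq_zero_of_ends hd) (N.finrank_solutions hd) N.bdry (N.extEnds X g)
    (fun v h1 h2 => by
      rw [inner_extEnds]
      exact Submodule.inner_left_of_mem_orthogonal
        (⟨v.1, (N.mem_J00_iff v).2 ⟨h1, h2⟩, rfl⟩ : N.conormal v.1 X ∈ N.DJ d X) hg)
  obtain ⟨hP, hQ⟩ := hu
  have hdisj : Disjoint X N.P := (N.disjoint_PQ.mono_right hX).symm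
  rw [SetLike.mem_coe, Submodule.mem_comap, map_sub, N.resEnds_extEnds_of_disjoint hdisj,
    sub_zero] at hP
  rw [SetLike.mem_coe, LinearMap.mem_ker, map_sub, sub_eq_zero] at hQ
  have hval : ∀ h : Fin N.n × Bool, N.endpoint h ∈ N.Q →
      u.1 h.1 (endParam h.2) = N.extEnds X g h :=
    fun h hh => congrArg (fun w : N.V N.Q => w ⟨h, hh⟩) hQ
  have htr : N.trace u.1 X = g := by
    ext k
    exact (hval k.1 (hX k.2)).trans (N.extEnds_of_mem g k.2)
  have := exists_isLExtension_of_solution hd hX (u := u.1)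
    ⟨u.2.1, u.2.2, hP, N.mem_bdry_orthogonal.1 hu'⟩ (by
      ext k
      exact (hval k.1 k.2.1).trans (N.extEnds_of_notMem g k.2.2))
  rwa [htr] at this

/-- The `L`-extension. -/
def lExt (hd : ∀ i, IsSmooth (d i)) (hX : X ⊆ N.Q) (g : (N.DJ d X)ᗮ) : N.Fn :=
  (exists_isLExtension hd hX g.2).choose

lemma isLExtension_lExt (hd : ∀ i, IsSmooth (d i)) (hX : X ⊆ N.Q) (g : (N.DJ d X)ᗮ) :
    N.IsLExtension d X g (lExt hd hX g) :=
  (exists_isLExtension hd hX g.2).choose_spec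

lemma lExt_add (hd : ∀ i, IsSmooth (d i)) (hX : X ⊆ N.Q) (g g' : (N.DJ d X)ᗮ) :
    lExt hd hX (g + g') = lExt hd hX g + lExt hd hX g' :=
  (isLExtension_lExt hd hX _).unique ((isLExtension_lExt hd hX g).add (isLExtension_lExt hd hX g'))

lemma lExt_smul (hd : ∀ i, IsSmooth (d i)) (hX : X ⊆ N.Q) (a : ℝ) (g : (N.DJ d X)ᗮ) :
    lExt hd hX (a • g) = a • lExt hd hX g :=
  (isLExtension_lExt hd hX _).unique ((isLExtension_lExt hd hX g).smul a)

lemma dn_eq (hd : ∀ i, IsSmooth (d i)) (hX : X ⊆ N.Q) (g : (N.DJ d X)ᗮ) :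
    (N.dn d X g : N.V X) = N.conormal (lExt hd hX g) X := by
  have h := exists_isLExtension hd hX g.2
  rw [dn, dif_pos h]
  exact congrArg (N.conormal · X) (h.choose_spec.unique (isLExtension_lExt hd hX g))

end Network

/-! ### Finite orthogonal sums, and Green's formula with boundary conditions. -/

lemma nonposDim_biSup {V : Type} [AddCommGroup V] [Module ℝ V] {B : LinearMap.BilinForm ℝ V}
    (hB : ∀ x y, B x y = B y x) {ι : Type*} {W : ι → Submodule ℝ V} (hi : iSupIndep W)
    (ho : ∀ i j, i ≠ j → ∀ x ∈ W i, ∀ y ∈ W j, B x y = 0) (s : Finset ι) :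
    nonposDim B (⨆ i ∈ s, W i) = ∑ i ∈ s, nonposDim B (W i) := by
  classical
  induction s using Finset.induction_on with
  | empty =>
    simp only [Finset.notMem_empty, iSup_false, iSup_bot, Finset.sum_empty]
    rw [nonposDim_eq_of_splitting (N := ⊥) (Z := ⊥) le_rfl (by simp) (by simp) (by simp), edim_bot]
  | insert j s hj ih =>
    have hle : ∀ i ∈ s, i ≠ j := fun i hi h => hj (h ▸ hi)
    rw [Finset.iSup_insert, Finset.sum_insert hj, ← ih]
    refine nonposDim_sup hB ((hi j).mono_right
      (iSup₂_le fun i his => le_iSup₂_of_le i (hle i his) le_rfl)) fun x hx y hy => ?_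
    have hk : (⨆ i ∈ s, W i) ≤ LinearMap.ker (B x) :=
      iSup₂_le fun i his z hz => LinearMap.mem_ker.2 (ho j i (hle i his).symm x hx z hz)
    exact LinearMap.mem_ker.1 (hk hy)

namespace Network

variable {N : Network} {d : N.Fn} {X : Set E3}

/-- Green's formula for functions with the boundary conditions of `W^{1,2}_{0,1}` off `X`. -/
lemma form_eq_inner_conormal (hX : X ⊆ N.Q) {u ψ : N.Fn} (hu : u ∈ N.sol d)
    (hψ : ψ ∈ N.sobolev) (hP : N.trace ψ N.P ∈ N.V1 N.P) (hQ : N.trace ψ (N.Q \ X) = 0) :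
    N.form d u ψ = ⟪N.conormal u X, N.trace ψ X⟫_ℝ := by
  -- Up to its values on X, ψ satisfies the conditions of `bdry`, which the conormal of u
  -- annihilates; so only the pairing on X survives.
  have hmem : N.endTrace ψ - N.extEnds X (N.trace ψ X) ∈ N.bdry := by
    refine ⟨?_, LinearMap.mem_ker.2 ?_⟩
    · rw [SetLike.mem_coe, Submodule.mem_comap, map_sub,
        N.resEnds_extEnds_of_disjoint (N.disjoint_PQ.mono_right hX).symm, sub_zero]
      exact hP
    · ext k
      change ψ k.1.1 (endParam k.1.2) - N.extEnds X (N.trace ψ X) k.1 = 0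
      by_cases hk : N.endpoint k.1 ∈ X
      · rw [N.extEnds_of_mem _ hk]
        exact sub_self _
      · rw [N.extEnds_of_notMem _ hk, sub_zero]
        exact congrArg (fun w : N.V (N.Q \ X) => w ⟨k.1, k.2, hk⟩) hQ
  have hc : N.endConormal d ⟨u, N.sol_le_solutions d hu⟩ ∈ N.bdryᗮ :=
    N.mem_bdry_orthogonal.2 hu.2.2.2
  have h0 := Submodule.inner_left_of_mem_orthogonal hmem hc
  rw [inner_sub_right, sub_eq_zero] at h0
  rw [N.form_eq_inner ⟨u, N.sol_le_solutions d hu⟩ hψ, h0, real_inner_comm, inner_extEnds,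
    real_inner_comm]
  rfl

/-- Solutions with the natural boundary conditions are orthogonal to `W^{1,2}_{0,1}`. -/
lemma form_eq_zero_of_mem_W {u ψ : N.Fn} (hu : u ∈ N.sol d) (hψ : ψ ∈ N.W) :
    N.form d u ψ = 0 := by
  rw [N.form_eq_inner ⟨u, N.sol_le_solutions d hu⟩ hψ.1]
  exact Submodule.inner_left_of_mem_orthogonal (N.mem_W_iff.1 hψ).2
    (N.mem_bdry_orthogonal.2 hu.2.2.2)

lemma form_zero_left (ψ : N.Fn) : N.form d 0 ψ = 0 := by
  simpa using N.form_smul_left d 0 0 ψ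

lemma J00_le_W : N.J00 d ≤ N.W :=
  fun _ hu => ⟨fun i => (hu.1.1 i).isW12, hu.1.2.2.1, hu.2⟩

end Network

/-! ### Boundary conditions on the network and on the pieces of a partition. -/

namespace Partition

variable {N : Network} {l : ℕ} {M : Fin l → Network} (p : Partition N M)

lemma isSmooth_restrict {d : N.Fn} (hd : ∀ i, IsSmooth (d i)) (i : Fin l)
    (j : Fin (M i).n) : IsSmooth (p.restrict d i j) := hd _

lemma Qtilde_subset (i : Fin l) : p.Qtilde i ⊆ (M i).Q := p.Q_eq i ▸ subset_union_left

lemma Qbar_subset (i : Fin l) : p.Qbar i ⊆ (M i).Q := p.Q_eq i ▸ subset_union_right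

lemma sdiff_Qtilde (i : Fin l) : (M i).Q \ p.Qtilde i = p.Qbar i := by
  rw [← p.Q_eq i, union_sdiff_left, (p.Q_disj i).symm.sdiff_eq_left]

lemma P_subset_Pin (i : Fin l) : (M i).P ⊆ p.Pin := p.Pin_eq ▸ subset_iUnion (fun i => (M i).P) i

lemma Pin_subset : p.Pin ⊆ N.P := p.P_eq ▸ subset_union_left

lemma Pbar_subset : p.Pbar ⊆ N.P := p.P_eq ▸ subset_union_right

lemma Qbar_subset_Q (i : Fin l) : p.Qbar i ⊆ N.Q := p.NQ_eq ▸ subset_iUnion p.Qbar i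

/-- Where an end of a piece can lie. -/
lemma endpoint_cases (i : Fin l) (j : Fin (M i).n) (b : Bool) :
    (M i).endpoint (j, b) ∈ (M i).P ∨ (M i).endpoint (j, b) ∈ p.Qtilde i ∨
      (M i).endpoint (j, b) ∈ p.Qbar i := by
  rcases (M i).endpoint_mem (j, b) with h | h
  · exact Or.inl h
  · rw [← p.Q_eq i] at h
    exact Or.inr h

/-- All curves of N that end at an interior endpoint of a piece belong to that piece. Hence the V_1
condition there, one tangent vector for all curves, can be checked on the piece alone. -/
lemma eq_of_endpoint_mem_P (p : Partition N M) {i i' : Fin l} {j : Fin (M i).n} {b : Bool}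
    (h : (M i).endpoint (j, b) ∈ (M i').P) : i = i' := by
  by_contra hne
  rcases p.endpoint_cases i j b with h' | h' | h'
  · exact disjoint_left.1 (p.Pin_disj hne) h' h
  · refine disjoint_left.1 p.P_disj (p.P_subset_Pin i' h) ?_
    rw [p.Pbar_eq]
    exact mem_iUnion.2 ⟨i, h'⟩
  · exact disjoint_left.1 N.disjoint_PQ (p.Pin_subset (p.P_subset_Pin i' h))
      (p.Qbar_subset_Q i h')

lemma endpoint_mem_Qtilde' {i : Fin l} {j : Fin (M i).n} {b : Bool}
    (h : (M i).endpoint (j, b) ∈ p.Pbar) : (M i).endpoint (j, b) ∈ p.Qtilde i := by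
  rcases p.endpoint_cases i j b with h' | h' | h'
  · exact absurd h (disjoint_left.1 p.P_disj (p.P_subset_Pin i h'))
  · exact h'
  · exact absurd (p.Qbar_subset_Q i h') (disjoint_left.1 N.disjoint_PQ (p.Pbar_subset h))

/-- The function on `N` with given restrictions to the pieces. -/
def assemble (φ : ∀ i, (M i).Fn) : N.Fn := fun k => φ (p.e.symm k).1 (p.e.symm k).2

lemma restrict_assemble (φ : ∀ i, (M i).Fn) (i : Fin l) : p.restrict (p.assemble φ) i = φ i :=
  funext fun j => congrArg (fun x : Σ i, Fin (M i).n => φ x.1 x.2) (p.e.symm_apply_apply ⟨i, j⟩)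

variable {p} in
lemma ext_restrict {φ ψ : N.Fn} (h : ∀ i, p.restrict φ i = p.restrict ψ i) : φ = ψ := by
  funext k
  obtain ⟨⟨i, j⟩, rfl⟩ := p.e.surjective k
  exact congrFun (h i) j

lemma form_eq_sum_restrict (d φ ψ : N.Fn) : N.form d φ ψ =
    ∑ i, (M i).form (p.restrict d i) (p.restrict φ i) (p.restrict ψ i) := by
  simp only [Network.form_eq_sum]
  rw [← p.e.sum_comp, Fintype.sum_sigma]
  simp only [p.curve_eq]
  rfl

lemma mem_sobolev_iff {φ : N.Fn} : φ ∈ N.sobolev ↔ ∀ i, p.restrict φ i ∈ (M i).sobolev := by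
  refine ⟨fun h i j => h _, fun h k => ?_⟩
  obtain ⟨⟨i, j⟩, rfl⟩ := p.e.surjective k
  exact h i j

lemma trace_restrict_Qtilde (φ : N.Fn) (i : Fin l) :
    (M i).trace (p.restrict φ i) (p.Qtilde i) = p.comp i (N.trace φ p.Pbar) := rfl

lemma trace_restrict_P {φ : N.Fn} (h : N.trace φ N.P ∈ N.V1 N.P) (i : Fin l) :
    (M i).trace (p.restrict φ i) (M i).P ∈ (M i).V1 (M i).P := by
  intro x hx
  obtain ⟨Y, hY, hv⟩ := h x (p.Pin_subset (p.P_subset_Pin i hx))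
  refine ⟨Y, hY, ?_⟩
  rintro ⟨⟨j, b⟩, hk⟩ hh
  have hx' : N.endpoint (p.e ⟨i, j⟩, b) = x := (p.endpoint_eq i j b).trans hh
  have := hv ⟨(p.e ⟨i, j⟩, b), by
    rw [hx']
    exact p.Pin_subset (p.P_subset_Pin i hx)⟩ hx'
  simp only [p.curve_eq] at this
  exact this

lemma trace_restrict_Qbar {φ : N.Fn} (h : N.trace φ N.Q = 0) (i : Fin l) :
    (M i).trace (p.restrict φ i) (p.Qbar i) = 0 := by
  ext ⟨⟨j, b⟩, hk⟩
  refine congrArg (fun w : N.V N.Q => w ⟨(p.e ⟨i, j⟩, b), ?_⟩) h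
  rw [p.endpoint_eq]
  exact p.Qbar_subset_Q i hk

lemma trace_Pbar_mem {φ : N.Fn} (h : N.trace φ N.P ∈ N.V1 N.P) :
    N.trace φ p.Pbar ∈ N.V1 p.Pbar := by
  intro x hx
  obtain ⟨Y, hY, hv⟩ := h x (p.Pbar_subset hx)
  exact ⟨Y, hY, fun k hk => hv ⟨k.1, p.Pbar_subset k.2⟩ hk⟩

/-- The boundary conditions on `N` in terms of those on the pieces. -/
lemma mem_W_of_restrict {φ : N.Fn} (hφ : φ ∈ N.sobolev)
    (hP : ∀ i, (M i).trace (p.restrict φ i) (M i).P ∈ (M i).V1 (M i).P)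
    (hQ : ∀ i, (M i).trace (p.restrict φ i) (p.Qbar i) = 0)
    (hPbar : N.trace φ p.Pbar ∈ N.V1 p.Pbar) : φ ∈ N.W := by
  refine ⟨hφ, fun x hx => ?_, ?_⟩
  · rw [← p.P_eq] at hx
    rcases hx with hx | hx
    · rw [p.Pin_eq] at hx
      obtain ⟨i, hi⟩ := mem_iUnion.1 hx
      obtain ⟨Y, hY, hv⟩ := hP i x hi
      refine ⟨Y, hY, ?_⟩
      rintro ⟨⟨k, b⟩, hk⟩ hh
      obtain ⟨⟨i', j⟩, rfl⟩ := p.e.surjective k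
      change N.endpoint (p.e ⟨i', j⟩, b) = x at hh
      rw [p.endpoint_eq] at hh
      obtain rfl : i' = i := p.eq_of_endpoint_mem_P (hh ▸ hi)
      have := hv ⟨(j, b), by rwa [hh]⟩ hh
      simp only [p.curve_eq]
      exact this
    · obtain ⟨Y, hY, hv⟩ := hPbar x hx
      exact ⟨Y, hY, fun k hk => hv ⟨k.1, by rwa [hk]⟩ hk⟩
  · ext ⟨⟨k, b⟩, hk⟩
    obtain ⟨⟨i, j⟩, rfl⟩ := p.e.surjective k
    have hk' := hk
    rw [p.endpoint_eq] at hk'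
    have hb : (M i).endpoint (j, b) ∈ p.Qbar i := by
      rcases p.endpoint_cases i j b with h | h | h
      · exact absurd hk' (disjoint_left.1 N.disjoint_PQ (p.Pin_subset (p.P_subset_Pin i h)))
      · refine absurd hk' (disjoint_left.1 N.disjoint_PQ (p.Pbar_subset ?_))
        rw [p.Pbar_eq]
        exact mem_iUnion.2 ⟨i, h⟩
      · exact h
    exact congrArg (fun w : (M i).V (p.Qbar i) => w ⟨(j, b), hb⟩) (hQ i)

lemma trace_Pbar_eq_of_comp {φ : N.Fn} {g : N.V p.Pbar}
    (h : ∀ i, (M i).trace (p.restrict φ i) (p.Qtilde i) = p.comp i g) :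
    N.trace φ p.Pbar = g := by
  ext ⟨⟨k, b⟩, hk⟩
  obtain ⟨⟨i, j⟩, rfl⟩ := p.e.surjective k
  have hk' := hk
  rw [p.endpoint_eq] at hk'
  exact congrArg (fun w : (M i).V (p.Qtilde i) => w ⟨(j, b), p.endpoint_mem_Qtilde' hk'⟩) (h i)

/-- The ends at `Pbar` are the disjoint union of the ends at the `Qtilde i`. -/
lemma ends_bijective : Function.Bijective
    (fun x : Σ i, (M i).EndsAt (p.Qtilde i) =>
      (⟨(p.e ⟨x.1, x.2.1.1⟩, x.2.1.2), p.endpoint_mem_Pbar x.2⟩ : N.EndsAt p.Pbar)) := by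
  constructor
  · rintro ⟨i, ⟨j, b⟩, h⟩ ⟨i', ⟨j', b'⟩, h'⟩ hh
    obtain ⟨h1, h2⟩ := Prod.mk.inj (Subtype.mk.inj hh)
    obtain ⟨rfl, h3⟩ := Sigma.mk.inj (p.e.injective h1)
    obtain rfl := eq_of_heq h3
    obtain rfl : b = b' := h2
    rfl
  · rintro ⟨⟨k, b⟩, hk⟩
    obtain ⟨⟨i, j⟩, rfl⟩ := p.e.surjective k
    have hk' := hk
    rw [p.endpoint_eq] at hk'
    exact ⟨⟨i, (j, b), p.endpoint_mem_Qtilde' hk'⟩, rfl⟩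

lemma glue_apply (g : ∀ i, (M i).V (p.Qtilde i)) (i : Fin l) (k : (M i).EndsAt (p.Qtilde i)) :
    p.glue g ⟨(p.e ⟨i, k.1.1⟩, k.1.2), p.endpoint_mem_Pbar k⟩ = g i k := by
  -- Generalising over the index lets the dependent equality `p.e.symm (p.e x) = x` be eliminated by
  -- substitution.
  have key : ∀ (x : Σ i, Fin (M i).n) (hx : (M x.1).endpoint (x.2, k.1.2) ∈ p.Qtilde x.1),
      x = ⟨i, k.1.1⟩ → g x.1 ⟨(x.2, k.1.2), hx⟩ = g i k := by
    rintro x hx rfl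
    rfl
  exact key _ _ (p.e.symm_apply_apply _)

lemma inner_glue (g : ∀ i, (M i).V (p.Qtilde i)) (h : N.V p.Pbar) :
    ⟪p.glue g, h⟫_ℝ = ∑ i, ⟪g i, p.comp i h⟫_ℝ := by
  simp only [Network.inner_ends]
  rw [← Fintype.sum_sigma' (fun i k => g i k * p.comp i h k)]
  refine (Fintype.sum_bijective _ p.ends_bijective _ _ fun x => ?_).symm
  rw [glue_apply]
  rfl

end Partition

/-! ### The orthogonal splitting of the form domain and the glued Dirichlet-to-Neumann map. -/

namespace Partition

variable {N : Network} {l : ℕ} {M : Fin l → Network} (p : Partition N M)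

/-- Restriction to a piece, on tuples of `W^{1,2}` functions. -/
def res (i : Fin l) : N.sobolev →ₗ[ℝ] (M i).sobolev where
  toFun φ := ⟨p.restrict φ i, p.mem_sobolev_iff.1 φ.2 i⟩
  map_add' _ _ := rfl
  map_smul' _ _ := rfl

lemma assemble_mem_sobolev {φ : ∀ i, (M i).Fn} (h : ∀ i, φ i ∈ (M i).sobolev) :
    p.assemble φ ∈ N.sobolev :=
  p.mem_sobolev_iff.2 fun i => by
    rw [p.restrict_assemble]
    exact h i

/-- Extension by zero from a piece, on tuples of `W^{1,2}` functions. -/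
def incl (i : Fin l) : (M i).sobolev →ₗ[ℝ] N.sobolev where
  toFun φ := ⟨p.assemble (Pi.single i φ.1), p.assemble_mem_sobolev fun j => by
    rcases eq_or_ne j i with rfl | h
    · rw [Pi.single_eq_same]
      exact φ.2
    · rw [Pi.single_eq_of_ne h]
      exact Submodule.zero_mem _⟩
  map_add' φ ψ := Subtype.ext <| ext_restrict fun j => by
    change p.restrict _ j = p.restrict _ j + p.restrict _ j
    simp only [p.restrict_assemble, Submodule.coe_add, Pi.single_add, Pi.add_apply]
  map_smul' a φ := Subtype.ext <| ext_restrict fun j => by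
    change p.restrict _ j = a • p.restrict _ j
    simp only [p.restrict_assemble, Submodule.coe_smul, Pi.single_smul, Pi.smul_apply]

lemma coe_res (i : Fin l) (φ : N.sobolev) : (p.res i φ : (M i).Fn) = p.restrict φ i := rfl

lemma coe_incl (i : Fin l) (φ : (M i).sobolev) :
    (p.incl i φ : N.Fn) = p.assemble (Pi.single i φ.1) := rfl

lemma res_incl_same (i : Fin l) (φ : (M i).sobolev) : p.res i (p.incl i φ) = φ := by
  refine Subtype.ext ?_
  rw [coe_res, coe_incl, p.restrict_assemble, Pi.single_eq_same]

lemma res_incl_of_ne {i j : Fin l} (h : j ≠ i) (φ : (M i).sobolev) :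
    p.res j (p.incl i φ) = 0 := by
  refine Subtype.ext ?_
  rw [coe_res, coe_incl, p.restrict_assemble, Pi.single_eq_of_ne h]
  rfl

variable {p} in
lemma ext_res {φ ψ : N.sobolev} (h : ∀ i, p.res i φ = p.res i ψ) : φ = ψ :=
  Subtype.ext (ext_restrict fun i => congrArg Subtype.val (h i))

variable {d : N.Fn} (hd : ∀ i, IsSmooth (d i))

lemma bform_eq_sum_res (φ ψ : N.sobolev) : N.bform hd φ ψ =
    ∑ i, (M i).bform (p.isSmooth_restrict hd i) (p.res i φ) (p.res i ψ) :=
  p.form_eq_sum_restrict d φ ψ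

lemma bform_incl (i : Fin l) (φ : (M i).sobolev) (ψ : N.sobolev) :
    N.bform hd (p.incl i φ) ψ = (M i).bform (p.isSmooth_restrict hd i) φ (p.res i ψ) := by
  rw [p.bform_eq_sum_res, Finset.sum_eq_single i, res_incl_same]
  · intro j _ h
    rw [p.res_incl_of_ne h, map_zero, LinearMap.zero_apply]
  · exact fun h => absurd (Finset.mem_univ i) h

lemma incl_injective (i : Fin l) : Function.Injective (p.incl i) :=
  Function.LeftInverse.injective (p.res_incl_same i)

/-- The functions whose restrictions to all pieces satisfy the boundary conditions there. -/
def piecesW : Submodule ℝ N.sobolev := ⨅ i, (M i).sobolevW.comap (p.res i)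

lemma mem_piecesW {φ : N.sobolev} : φ ∈ p.piecesW ↔ ∀ i, p.restrict φ i ∈ (M i).W := by
  simp only [piecesW, Submodule.mem_iInf]
  rfl

lemma piecesW_eq_iSup : p.piecesW = ⨆ i ∈ Finset.univ, (M i).sobolevW.map (p.incl i) := by
  apply le_antisymm
  · intro φ hφ
    have e : φ = ∑ i, p.incl i (p.res i φ) := by
      refine ext_res (p := p) fun j => ?_
      rw [map_sum, Finset.sum_eq_single j, res_incl_same]
      · exact fun i _ h => p.res_incl_of_ne h.symm _
      · exact fun h => absurd (Finset.mem_univ j) h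
    rw [e]
    refine Submodule.sum_mem _ fun i hi => ?_
    exact Submodule.mem_iSup_of_mem i (Submodule.mem_iSup_of_mem hi
      ⟨_, (Submodule.mem_iInf _).1 hφ i, rfl⟩)
  · refine iSup₂_le fun i _ => ?_
    rintro _ ⟨φ, hφ, rfl⟩
    refine (Submodule.mem_iInf _).2 fun j => ?_
    rw [Submodule.mem_comap]
    rcases eq_or_ne j i with rfl | h
    · rw [res_incl_same]
      exact hφ
    · rw [p.res_incl_of_ne h]
      exact Submodule.zero_mem _

/-- Extension by zero embeds the Sobolev space of each piece isometrically, and different pieces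
have disjoint supports, so the images are independent and orthogonal. -/
lemma nonposDim_piecesW : nonposDim (N.bform hd) p.piecesW =
    ∑ i, nonposDim ((M i).bform (p.isSmooth_restrict hd i)) (M i).sobolevW := by
  have hi : iSupIndep fun i => (M i).sobolevW.map (p.incl i) := by
    intro i
    have hle : (⨆ j, ⨆ (_ : j ≠ i), (M j).sobolevW.map (p.incl j)) ≤ LinearMap.ker (p.res i) := by
      refine iSup₂_le fun j hj => ?_
      rintro _ ⟨φ, -, rfl⟩
      exact LinearMap.mem_ker.2 (p.res_incl_of_ne hj.symm φ)
    refine Disjoint.mono_right hle (Submodule.disjoint_def.2 ?_)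
    rintro _ ⟨φ, -, rfl⟩ h
    rw [LinearMap.mem_ker, res_incl_same] at h
    rw [h, map_zero]
  rw [piecesW_eq_iSup, nonposDim_biSup (N.bform_symm hd) hi]
  · refine Finset.sum_congr rfl fun i _ => nonposDim_map (p.incl_injective i) fun φ ψ => ?_
    rw [bform_incl, res_incl_same]
  · rintro i j hij _ ⟨φ, -, rfl⟩ _ ⟨ψ, -, rfl⟩
    rw [bform_incl, p.res_incl_of_ne hij, map_zero]

/-- The functions whose restrictions to all pieces are in `J_0^0`. -/
def piecesJ (d : N.Fn) : Submodule ℝ N.sobolev :=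
  ⨅ i, (((M i).J00 (p.restrict d i)).comap (M i).sobolev.subtype).comap (p.res i)

lemma mem_piecesJ {φ : N.sobolev} :
    φ ∈ p.piecesJ d ↔ ∀ i, p.restrict φ i ∈ (M i).J00 (p.restrict d i) := by
  simp only [piecesJ, Submodule.mem_iInf]
  rfl

lemma piecesJ_le : p.piecesJ d ≤ p.piecesW := fun _ h =>
  p.mem_piecesW.2 fun i => Network.J00_le_W (p.mem_piecesJ.1 h i)

/-- Such functions vanish on P̄, and 0 is in V_1. -/
lemma piecesW_le : p.piecesW ≤ N.sobolevW := by
  intro φ hφ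
  rw [mem_piecesW] at hφ
  refine p.mem_W_of_restrict φ.2 (fun i => (hφ i).2.1) (fun i => ?_) ?_
  · ext k
    exact congrArg (fun w : (M i).V (M i).Q => w ⟨k.1, p.Qbar_subset i k.2⟩) (hφ i).2.2
  · have : N.trace φ.1 p.Pbar = 0 := p.trace_Pbar_eq_of_comp fun i => by
      rw [map_zero]
      ext k
      exact congrArg (fun w : (M i).V (M i).Q => w ⟨k.1, p.Qtilde_subset i k.2⟩) (hφ i).2.2
    exact this ▸ Submodule.zero_mem _

lemma piecesJ_le_solutions : p.piecesJ d ≤ (N.solutions d).comap N.sobolev.subtype := by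
  intro φ hφ
  rw [mem_piecesJ] at hφ
  refine ⟨fun k => ?_, fun k t => ?_⟩ <;> obtain ⟨⟨i, j⟩, rfl⟩ := p.e.surjective k
  · exact (hφ i).1.1 j
  · have := (hφ i).1.2.1 j t
    simp only [Network.opL, p.curve_eq] at this ⊢
    exact this

lemma finiteDimensional_piecesJ (hd : ∀ i, IsSmooth (d i)) : FiniteDimensional ℝ (p.piecesJ d) := by
  have := N.finiteDimensional_solutions hd
  have : FiniteDimensional ℝ ((N.solutions d).comap N.sobolev.subtype) :=
    Module.Finite.equiv (Submodule.comapSubtypeEquivOfLe (N.solutions_le_sobolev d)).symm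
  exact Submodule.finiteDimensional_of_le p.piecesJ_le_solutions

/-- Gluing the `L`-extensions of the components. -/
def glueExt : p.V1bar d →ₗ[ℝ] N.sobolev where
  toFun g := ⟨p.assemble fun i => Network.lExt (p.isSmooth_restrict hd i) (p.Qtilde_subset i)
      ⟨p.comp i g, p.comp_mem g i⟩, p.assemble_mem_sobolev fun i j =>
        ((Network.isLExtension_lExt (p.isSmooth_restrict hd i) (p.Qtilde_subset i)
          ⟨p.comp i g, p.comp_mem g i⟩).mem_sol.1 j).isW12⟩
  map_add' g h := Subtype.ext <| ext_restrict fun i => by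
    change p.restrict _ i = p.restrict _ i + p.restrict _ i
    simp only [p.restrict_assemble]
    exact Network.lExt_add (p.isSmooth_restrict hd i) (p.Qtilde_subset i)
      ⟨p.comp i g, p.comp_mem g i⟩ ⟨p.comp i h, p.comp_mem h i⟩
  map_smul' a g := Subtype.ext <| ext_restrict fun i => by
    change p.restrict _ i = a • p.restrict _ i
    simp only [p.restrict_assemble]
    exact Network.lExt_smul (p.isSmooth_restrict hd i) (p.Qtilde_subset i) a
      ⟨p.comp i g, p.comp_mem g i⟩

lemma coe_glueExt (g : p.V1bar d) : (p.glueExt hd g : N.Fn) =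
    p.assemble fun i => Network.lExt (p.isSmooth_restrict hd i) (p.Qtilde_subset i)
      ⟨p.comp i g, p.comp_mem g i⟩ := rfl

lemma restrict_glueExt (g : p.V1bar d) (i : Fin l) : p.restrict (p.glueExt hd g) i =
    Network.lExt (p.isSmooth_restrict hd i) (p.Qtilde_subset i)
      ⟨p.comp i g, p.comp_mem g i⟩ := by
  rw [coe_glueExt, p.restrict_assemble]

lemma isLExtension_restrict_glueExt (g : p.V1bar d) (i : Fin l) :
    (M i).IsLExtension (p.restrict d i) (p.Qtilde i) (p.comp i g)
      (p.restrict (p.glueExt hd g) i) := by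
  rw [restrict_glueExt]
  exact Network.isLExtension_lExt (p.isSmooth_restrict hd i) (p.Qtilde_subset i)
    ⟨p.comp i g, p.comp_mem g i⟩

lemma trace_glueExt (g : p.V1bar d) : N.trace (p.glueExt hd g) p.Pbar = g :=
  p.trace_Pbar_eq_of_comp fun i => (p.isLExtension_restrict_glueExt hd g i).trace_eq

lemma trace_glueExt_Qbar (g : p.V1bar d) (i : Fin l) :
    (M i).trace (p.restrict (p.glueExt hd g) i) ((M i).Q \ p.Qtilde i) = 0 :=
  (p.isLExtension_restrict_glueExt hd g i).trace_eq_zero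

lemma glueExt_mem (g : p.V1bar d) : p.glueExt hd g ∈ N.sobolevW := by
  refine p.mem_W_of_restrict (p.glueExt hd g).2
    (fun i => (p.isLExtension_restrict_glueExt hd g i).mem_sol.2.2.1) (fun i => ?_) ?_
  · rw [← p.sdiff_Qtilde i]
    exact p.trace_glueExt_Qbar hd g i
  · exact (p.trace_glueExt hd g).symm ▸ g.2.1

lemma glueExt_injective : Function.Injective (p.glueExt hd) := by
  intro g h hgh
  refine Subtype.ext ?_
  rw [← p.trace_glueExt hd g, hgh, p.trace_glueExt hd h]

lemma bform_glueExt_piecesW (g : p.V1bar d) {φ : N.sobolev} (hφ : φ ∈ p.piecesW) :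
    N.bform hd (p.glueExt hd g) φ = 0 := by
  rw [p.bform_eq_sum_res]
  exact Finset.sum_eq_zero fun i _ => Network.form_eq_zero_of_mem_W
    (p.isLExtension_restrict_glueExt hd g i).mem_sol (p.mem_piecesW.1 hφ i)

/-- Green's formula on each piece turns the form into the pairing of T_i with the components of h.
The projection in T̄ is invisible because h lies in V̄_1. Linearity and symmetry of T̄ are read off
from this identity. -/
lemma bform_glueExt (g h : p.V1bar d) :
    N.bform hd (p.glueExt hd g) (p.glueExt hd h) = ⟪p.Tbar d g, h⟫_ℝ := by
  have e : ⟪p.Tbar d g, h⟫_ℝ = ⟪p.That d g, (h : N.V p.Pbar)⟫_ℝ :=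
    Submodule.inner_orthogonalProjectionOnto_eq_of_mem_right h _
  rw [e, That, inner_glue, p.bform_eq_sum_res]
  refine Finset.sum_congr rfl fun i _ => ?_
  have hh := p.isLExtension_restrict_glueExt hd h i
  have hg := p.isLExtension_restrict_glueExt hd g i
  have := Network.form_eq_inner_conormal (p.Qtilde_subset i) hg.mem_sol
    (fun j => (hh.mem_sol.1 j).isW12) hh.mem_sol.2.2.1 hh.trace_eq_zero
  rw [hh.trace_eq, restrict_glueExt p hd g, ← Network.dn_eq] at this
  rw [← this, ← restrict_glueExt p hd g]
  rfl

/-- The glued Dirichlet-to-Neumann map as a linear map. -/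
def linTbar : p.V1bar d →ₗ[ℝ] p.V1bar d where
  toFun := p.Tbar d
  map_add' g g' := ext_inner_right ℝ fun h => by
    simp only [inner_add_left, ← p.bform_glueExt hd, map_add, LinearMap.add_apply]
  map_smul' a g := ext_inner_right ℝ fun h => by
    simp only [inner_smul_left, ← p.bform_glueExt hd, map_smul, LinearMap.smul_apply]
    rfl

lemma linTbar_isSymmetric : (p.linTbar hd).IsSymmetric := by
  intro g h
  change ⟪p.Tbar d g, h⟫_ℝ = ⟪g, p.Tbar d h⟫_ℝ
  rw [real_inner_comm (p.Tbar d h), ← p.bform_glueExt hd, ← p.bform_glueExt hd, N.bform_symm]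

/-- The span in the definition adds nothing, once T̄ is known to be linear. -/
lemma eigenspace_eq (σ : ℝ) :
    p.eigenspace d σ = Module.End.eigenspace (p.linTbar hd) σ := by
  rw [eigenspace]
  conv_rhs => rw [← Submodule.span_eq (Module.End.eigenspace (p.linTbar hd) σ)]
  congr 1
  ext g
  rw [SetLike.mem_coe, Module.End.mem_eigenspace_iff]
  rfl

lemma nonposDim_range_glueExt :
    nonposDim (N.bform hd) (LinearMap.range (p.glueExt hd)) =
      (p.indexTbar d : ℕ∞) + (p.nullityTbar d : ℕ∞) := by
  rw [LinearMap.range_eq_map, nonposDim_map (V := p.V1bar d) (B := (N.bform hd).compl₁₂ (p.glueExt hd)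
    (p.glueExt hd)) (p.glueExt_injective hd) fun _ _ => rfl,
    nonposDim_of_isSymmetric (p.linTbar_isSymmetric hd) fun g h => p.bform_glueExt hd g h]
  rw [indexTbar, nullityTbar, p.eigenspace_eq hd,
    iSup_congr fun σ : {σ : ℝ // σ < 0} => p.eigenspace_eq hd σ]

/-- Test φ against an element u of J_0^0 of one piece, extended by zero: by Green's formula the form
is the pairing of ∂u/∂τ with the trace of φ on Q̃_i. -/
lemma comp_trace_mem {φ : N.sobolev} (hφ : φ ∈ orthIn (N.bform hd) N.sobolevW (p.piecesJ d))
    (i : Fin l) :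
    p.comp i (N.trace φ p.Pbar) ∈ ((M i).DJ (p.restrict d i) (p.Qtilde i))ᗮ := by
  rw [Submodule.mem_orthogonal]
  rintro _ ⟨u, hu, rfl⟩
  have hus : u ∈ (M i).sobolev := (Network.J00_le_W hu).1
  have h0 := hφ.2 (p.incl i ⟨u, hus⟩) (p.mem_piecesJ.2 fun j => by
    rcases eq_or_ne j i with rfl | h
    · rw [← coe_res, res_incl_same]
      exact hu
    · rw [← coe_res, p.res_incl_of_ne h]
      exact Submodule.zero_mem _)
  rw [N.bform_symm, bform_incl] at h0
  rw [← trace_restrict_Qtilde, ← coe_res, ← Network.form_eq_inner_conormal (p.Qtilde_subset i) hu.1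
    (p.res i φ).2 (p.trace_restrict_P hφ.1.2.1 i)]
  · exact h0
  · rw [p.sdiff_Qtilde i]
    exact p.trace_restrict_Qbar hφ.1.2.2 i

/-- Orthogonality to K puts the trace on P̄ into V̄_1, so it has a glued extension; the difference
vanishes at every boundary endpoint of every piece. Conversely, elements of K solve Lu = 0 with
natural boundary conditions, so they are orthogonal to both summands. -/
lemma orthIn_piecesJ : orthIn (N.bform hd) N.sobolevW (p.piecesJ d) =
    p.piecesW ⊔ LinearMap.range (p.glueExt hd) := by
  apply le_antisymm
  · intro φ hφ
    let g : p.V1bar d := ⟨N.trace φ p.Pbar, p.trace_Pbar_mem hφ.1.2.1,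
      (Submodule.mem_iInf _).2 fun i => p.comp_trace_mem hd hφ i⟩
    rw [← sub_add_cancel φ (p.glueExt hd g)]
    refine Submodule.add_mem_sup (p.mem_piecesW.2 fun i => ?_) ⟨g, rfl⟩
    have e : p.restrict (φ - p.glueExt hd g : N.sobolev) i =
        p.restrict φ i + (-1 : ℝ) • p.restrict (p.glueExt hd g) i := by
      rw [neg_one_smul, ← sub_eq_add_neg]
      rfl
    have hg := p.isLExtension_restrict_glueExt hd g i
    refine ⟨p.mem_sobolev_iff.1 (φ - p.glueExt hd g).2 i, ?_, ?_⟩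
    · rw [e, Network.trace_add, Network.trace_smul]
      exact Submodule.add_mem _ (p.trace_restrict_P hφ.1.2.1 i)
        (Submodule.smul_mem _ _ hg.mem_sol.2.2.1)
    · refine Network.trace_eq_zero_of_diff (X := p.Qtilde i) ?_ ?_
      · rw [e, Network.trace_add, Network.trace_smul, hg.trace_eq, trace_restrict_Qtilde,
          neg_one_smul]
        exact add_neg_cancel _
      · rw [e, Network.trace_add, Network.trace_smul, hg.trace_eq_zero, smul_zero, add_zero,
          p.sdiff_Qtilde i]
        exact p.trace_restrict_Qbar hφ.1.2.2 i
  · refine sup_le (fun φ hφ => ⟨p.piecesW_le hφ, fun k hk => ?_⟩) ?_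
    · rw [N.bform_symm, p.bform_eq_sum_res]
      exact Finset.sum_eq_zero fun i _ => Network.form_eq_zero_of_mem_W
        (p.mem_piecesJ.1 hk i).1 (p.mem_piecesW.1 hφ i)
    · rintro _ ⟨g, rfl⟩
      exact ⟨p.glueExt_mem hd g, fun k hk => p.bform_glueExt_piecesW hd g (p.piecesJ_le hk)⟩

lemma disjoint_piecesW_range_glueExt :
    Disjoint p.piecesW (LinearMap.range (p.glueExt hd)) := by
  rw [Submodule.disjoint_def]
  rintro _ h ⟨g, rfl⟩
  have hg : g = 0 := by
    refine Subtype.ext ?_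
    rw [← p.trace_glueExt hd g]
    refine p.trace_Pbar_eq_of_comp fun i => ?_
    ext k
    exact congrArg (fun w : (M i).V (M i).Q => w ⟨k.1, p.Qtilde_subset i k.2⟩)
      (p.mem_piecesW.1 h i).2.2
  rw [hg, map_zero]

/-- Passing to the orthogonal of K is free because K is isotropic; what remains is an orthogonal
direct sum. -/
theorem nonposDim_sobolevW : nonposDim (N.bform hd) N.sobolevW =
    ∑ i, nonposDim ((M i).bform (p.isSmooth_restrict hd i)) (M i).sobolevW +
      ((p.indexTbar d : ℕ∞) + (p.nullityTbar d : ℕ∞)) := by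
  have : FiniteDimensional ℝ (p.piecesJ d) := p.finiteDimensional_piecesJ hd
  rw [← nonposDim_orthIn (K := p.piecesJ d) (N.bform_symm hd) (p.piecesJ_le.trans p.piecesW_le),
    orthIn_piecesJ,
    nonposDim_sup (N.bform_symm hd) (p.disjoint_piecesW_range_glueExt hd), nonposDim_piecesW,
    nonposDim_range_glueExt]
  · rintro φ hφ _ ⟨g, rfl⟩
    rw [N.bform_symm]
    exact p.bform_glueExt_piecesW hd g hφ
  · intro x hx y hy
    rw [p.bform_eq_sum_res]
    exact Finset.sum_eq_zero fun i _ => Network.form_eq_zero_of_mem_W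
      (p.mem_piecesJ.1 hx i).1 (Network.J00_le_W (p.mem_piecesJ.1 hy i))

end Partition

end SphereNetwork

end

theorem mainTheorem4 (N : SphereNetwork.Network) (l : ℕ) (M : Fin l → SphereNetwork.Network)
    (p : SphereNetwork.Partition N M) (d : N.Fn) (hd : ∀ i, SphereNetwork.IsSmooth (d i)) :
    (∀ (i : Fin l) (g : ((M i).DJ (p.restrict d i) (p.Qtilde i))ᗮ),
      ∃! u, (M i).IsLExtension (p.restrict d i) (p.Qtilde i) g u) ∧
    N.index d + N.nullity d =
      ∑ i, ((M i).index (p.restrict d i) + (M i).nullity (p.restrict d i)) +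
        ((p.indexTbar d : ℕ∞) + (p.nullityTbar d : ℕ∞)) := by
  refine ⟨fun i g => ?_, ?_⟩
  · obtain ⟨u, hu⟩ := SphereNetwork.Network.exists_isLExtension (p.isSmooth_restrict hd i)
      (p.Qtilde_subset i) g.2
    exact ⟨u, hu, fun v hv => hv.unique hu⟩
  · rw [N.index_add_nullity hd, p.nonposDim_sobolevW hd]
    congr 1
    exact Finset.sum_congr rfl fun i _ =>
      ((M i).index_add_nullity (p.isSmooth_restrict hd i)).symm
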